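/- Let $M$ be a connected smooth manifold of dimension $n\ge 3$, let $TM$ be its tangent bundle, $T_0M=TM\setminus 0$, and let $(x^i,y^i)$ denote the coordinates on $TM$ induced by local coordinates $(x^i)$ of $M$. Let $F:TM\to\mathbb R$ be a Finsler metric: $F$ is continuous, positive and smooth on $T_0M$, positively $1$-homogeneous in the fibre coordinates, and in all induced coordinates the matrix $g_{ij}=\frac12\frac{\partial^2F^2}{\partial y^i\partial y^j}$ is positive definite on $T_0M$. Let $S=y^i\frac{\partial}{\partial x^i}-2G^i\frac{\partial}{\partial y^i}$ be the geodesic spray of $F$, that is, the solution of $S\!\left(\frac{\partial F^2}{\partial y^l}\right)-\frac{\partial F^2}{\partial x^l}=0$, so that $$G^i=\tfrac14 g^{il}\Big(y^k\frac{\partial^2F^2}{\partial x^k\partial y^l}-\frac{\partial F^2}{\partial x^l}\Big),$$ let $J=\frac{\partial}{\partial y^i}\otimes dx^i$, $\mathcal C=y^i\frac{\partial}{\partial y^i}$, $d_Jf=\frac{\partial f}{\partial y^i}dx^i$, and let $$\Phi=R^i_j\frac{\partial}{\partial y^i}\otimes dx^j,\qquad R^i_j=2\frac{\partial G^i}{\partial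 x^j}-S\Big(\frac{\partial G^i}{\partial y^j}\Big)-\frac{\partial G^i}{\partial y^k}\frac{\partial G^k}{\partial y^j},$$ be the Jacobi endomorphism of $S$, with $\operatorname{Tr}\Phi=R^l_l$. One says that $F$ has scalar flag curvature if there is a function $\kappa\in C^\infty(T_0M)$ with $\Phi=\kappa\,(F^2J-F\,d_JF\otimes\mathcal C)$ on $T_0M$, and that $F$ has constant flag curvature if this holds for a constant $\kappa\in\mathbb R$. Define on $T_0M$ the Weyl-type tensor $$W_0=\Phi-\frac1{n-1}(\operatorname{Tr}\Phi)J+\frac1{2(n-1)}d_J(\operatorname{Tr}\Phi)\otimes\mathcal C$$ and the classical projective Weyl tensor $W=W^i_j\frac{\partial}{\partial y^i}\otimes dx^j$, $$W^i_j=R^i_j-\frac1{n-1}R^l_l\delta^i_j-\frac1{n+1}\frac{\partial}{\partial y^m}\Big(R^m_j-\frac1{n-1}R^l_l\delta^m_j\Big)y^i.$$ Then the following conditions are equivalent: (i) $F$ has constant flag curvature; (ii) $W_0=0$ on $T_0M$; (iii) $F$ has scalar flag curvature and $W_0=W$ on $T_0M$. -/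

import Mathlib

open scoped Manifold ContDiff

noncomputable section

namespace FinslerGeom

/-- The model space `ℝⁿ`. A point `(x, y)` of `Coord n × Coord n` stands for the induced local
coordinates `(xⁱ, yⁱ)` on the tangent bundle. -/
abbrev Coord (n : ℕ) : Type := EuclideanSpace ℝ (Fin n)

section Local

variable {n : ℕ}

/-- The partial derivative `∂f/∂xⁱ` of a function of `(x, y)`. -/
def dx (i : Fin n) (f : Coord n × Coord n → ℝ) (p : Coord n × Coord n) : ℝ :=
  fderiv ℝ f p (EuclideanSpace.single i 1, 0)

/-- The partial derivative `∂f/∂yⁱ` of a function of `(x, y)`. -/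
def dy (i : Fin n) (f : Coord n × Coord n → ℝ) (p : Coord n × Coord n) : ℝ :=
  fderiv ℝ f p (0, EuclideanSpace.single i 1)

/-- The metric tensor `gᵢⱼ = ½ ∂²F²/∂yⁱ∂yʲ`. -/
def metricTensor (F : Coord n × Coord n → ℝ) (p : Coord n × Coord n) :
    Matrix (Fin n) (Fin n) ℝ :=
  Matrix.of fun i j => (1 / 2) * dy i (dy j fun q => F q ^ 2) p

/-- The coefficients `Gⁱ` of the geodesic spray `S = yⁱ ∂/∂xⁱ - 2 Gⁱ ∂/∂yⁱ` of `F`. The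
Euler-Lagrange equation `S(∂F²/∂yˡ) - ∂F²/∂xˡ = 0` reads
`yᵏ ∂²F²/∂xᵏ∂yˡ - 4 gₗᵢ Gⁱ - ∂F²/∂xˡ = 0`; this is its unique solution where `g` is invertible,
`Gⁱ = ¼ gⁱˡ (yᵏ ∂²F²/∂xᵏ∂yˡ - ∂F²/∂xˡ)`. -/
def sprayCoeff (F : Coord n × Coord n → ℝ) (i : Fin n) (p : Coord n × Coord n) : ℝ :=
  (1 / 4) * ∑ l, (metricTensor F p)⁻¹ i l *
    ((∑ k, p.2 k * dx k (dy l fun q => F q ^ 2) p) - dx l (fun q => F q ^ 2) p)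

/-- The derivative `S(f) = yᵏ ∂f/∂xᵏ - 2 Gᵏ ∂f/∂yᵏ` of a function along the spray with
coefficients `G`. -/
def sprayDeriv (G : Fin n → Coord n × Coord n → ℝ) (f : Coord n × Coord n → ℝ)
    (p : Coord n × Coord n) : ℝ :=
  ∑ k, (p.2 k * dx k f p - 2 * G k p * dy k f p)

/-- The components `Rⁱⱼ = 2 ∂Gⁱ/∂xʲ - S(∂Gⁱ/∂yʲ) - (∂Gⁱ/∂yᵏ)(∂Gᵏ/∂yʲ)` of the Jacobi
endomorphism `Φ = Rⁱⱼ ∂/∂yⁱ ⊗ dxʲ` of the spray with coefficients `G`. -/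
def jacobi (G : Fin n → Coord n × Coord n → ℝ) (i j : Fin n) (p : Coord n × Coord n) : ℝ :=
  2 * dx j (G i) p - sprayDeriv G (dy j (G i)) p - ∑ k, dy k (G i) p * dy j (G k) p

/-- The trace `Tr Φ = Rˡₗ`. -/
def jacobiTrace (G : Fin n → Coord n × Coord n → ℝ) (p : Coord n × Coord n) : ℝ :=
  ∑ l, jacobi G l l p

/-- The Kronecker symbol `δⁱⱼ`, the components of the tangent structure `J = ∂/∂yⁱ ⊗ dxⁱ`. -/
def kron (i j : Fin n) : ℝ := if i = j then 1 else 0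

/-- The components `Rⁱⱼ - Rˡₗ δⁱⱼ / (n-1) + (∂Rˡₗ/∂yʲ) yⁱ / (2(n-1))` of the Weyl-type tensor
`W₀ = Φ - (Tr Φ) J / (n-1) + d_J (Tr Φ) ⊗ C / (2(n-1))`. -/
def weylType (G : Fin n → Coord n × Coord n → ℝ) (i j : Fin n) (p : Coord n × Coord n) : ℝ :=
  jacobi G i j p - 1 / ((n : ℝ) - 1) * jacobiTrace G p * kron i j
    + 1 / (2 * ((n : ℝ) - 1)) * dy j (jacobiTrace G) p * p.2 i

/-- The components of the classical projective Weyl tensor,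
`Rⁱⱼ - Rˡₗ δⁱⱼ / (n-1) - yⁱ ∂/∂yᵐ (Rᵐⱼ - Rˡₗ δᵐⱼ / (n-1)) / (n+1)`. -/
def weyl (G : Fin n → Coord n × Coord n → ℝ) (i j : Fin n) (p : Coord n × Coord n) : ℝ :=
  jacobi G i j p - 1 / ((n : ℝ) - 1) * jacobiTrace G p * kron i j
    - 1 / ((n : ℝ) + 1)
      * (∑ m, dy m (fun q => jacobi G m j q - 1 / ((n : ℝ) - 1) * jacobiTrace G q * kron m j) p)
      * p.2 i

end Local

section Global

variable {n : ℕ} {M : Type*} [TopologicalSpace M] [ChartedSpace (Coord n) M]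

/-- The tangent vector `yⁱ ∂/∂xⁱ` at the point with coordinates `x` in the chart `e`. -/
def vectorOfCoord (e : OpenPartialHomeomorph M (Coord n)) (p : Coord n × Coord n) :
    TangentBundle (𝓡 n) M :=
  ⟨e.symm p.1, mfderiv (𝓡 n) (𝓡 n) e.symm p.1 p.2⟩

/-- The expression of a function on `TM` in the coordinates `(x, y)` induced by the chart `e`. -/
def inChart (F : TangentBundle (𝓡 n) M → ℝ) (e : OpenPartialHomeomorph M (Coord n)) :
    Coord n × Coord n → ℝ :=
  fun p => F (vectorOfCoord e p)

/-- The coefficients, in the coordinates induced by `e`, of the geodesic spray of `F`. -/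
def sprayInChart (F : TangentBundle (𝓡 n) M → ℝ) (e : OpenPartialHomeomorph M (Coord n)) :
    Fin n → Coord n × Coord n → ℝ :=
  sprayCoeff (inChart F e)

variable (n M) in
/-- The slit tangent bundle `T₀M`. -/
def slit : Set (TangentBundle (𝓡 n) M) := {v | v.2 ≠ 0}

variable (n M) in
/-- `IsSlitCoord n M e p`: the chart `e` belongs to the smooth structure of `M`, and `p = (x, y)`
are the coordinates induced by `e` of a point of `T₀M`. -/
def IsSlitCoord [IsManifold (𝓡 n) ∞ M] (e : OpenPartialHomeomorph M (Coord n))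
    (p : Coord n × Coord n) : Prop :=
  e ∈ IsManifold.maximalAtlas (𝓡 n) ∞ M ∧ p.1 ∈ e.target ∧ p.2 ≠ 0

variable [IsManifold (𝓡 n) ∞ M]

/-- Finsler metrics `F : TM → ℝ`. -/
structure IsFinslerMetric (F : TangentBundle (𝓡 n) M → ℝ) : Prop where
  continuous : Continuous F
  pos : ∀ v ∈ slit n M, 0 < F v
  smooth : ContMDiffOn (𝓡 n).tangent 𝓘(ℝ, ℝ) ∞ F (slit n M)
  homogeneous : ∀ (x : M) (y : TangentSpace (𝓡 n) x) (c : ℝ), 0 < c →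
    F ⟨x, c • y⟩ = c * F ⟨x, y⟩
  posDef : ∀ e p, IsSlitCoord n M e p → (metricTensor (inChart F e) p).PosDef

/-- `Φ = κ (F² J - F d_J F ⊗ C)` on `T₀M`, for the Jacobi endomorphism `Φ` of the geodesic spray
of `F`. -/
def HasFlagCurvature (F κ : TangentBundle (𝓡 n) M → ℝ) : Prop :=
  ∀ e p, IsSlitCoord n M e p → ∀ i j,
    jacobi (sprayInChart F e) i j p =
      inChart κ e p *
        (inChart F e p ^ 2 * kron i j - inChart F e p * dy j (inChart F e) p * p.2 i)

/-- `F` has scalar flag curvature, for some function `κ ∈ C^∞(T₀M)`. -/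
def HasScalarFlagCurvature (F : TangentBundle (𝓡 n) M → ℝ) : Prop :=
  ∃ κ : TangentBundle (𝓡 n) M → ℝ,
    ContMDiffOn (𝓡 n).tangent 𝓘(ℝ, ℝ) ∞ κ (slit n M) ∧ HasFlagCurvature F κ

/-- `F` has constant flag curvature. -/
def HasConstantFlagCurvature (F : TangentBundle (𝓡 n) M → ℝ) : Prop :=
  ∃ c : ℝ, HasFlagCurvature F fun _ => c

/-- The Weyl-type tensor `W₀` of the geodesic spray of `F` vanishes on `T₀M`. -/
def WeylTypeVanishes (F : TangentBundle (𝓡 n) M → ℝ) : Prop :=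
  ∀ e p, IsSlitCoord n M e p → ∀ i j, weylType (sprayInChart F e) i j p = 0

/-- The Weyl-type tensor of the geodesic spray of `F` coincides on `T₀M` with the classical
projective Weyl tensor. -/
def WeylTypeEqWeyl (F : TangentBundle (𝓡 n) M → ℝ) : Prop :=
  ∀ e p, IsSlitCoord n M e p → ∀ i j,
    weylType (sprayInChart F e) i j p = weyl (sprayInChart F e) i j p

end Global

end FinslerGeom

end

/-! Write θ = F d_J F and let C(κ) be the derivative of κ along the Liouville field. If Φ = κ (F² J
− θ ⊗ C), then Tr Φ = (n−1) κ F², and direct computation gives W₀ = ½ F² d_Jκ ⊗ C (`weylType_eq`)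
and W = C(κ)/(n+1) · θ ⊗ C (`weyl_eq`). Both vanish for constant κ, so (i) implies (ii) and (iii).

Conversely, (ii) and (iii) each make Φ isotropic with d_Jκ = 0. Under (iii), evaluating W₀ = W on y
gives (1/2 − 1/(n+1)) F² C(κ) = 0, hence C(κ) = 0 and then d_Jκ = 0
(`vertical_of_weylType_eq_weyl`). Under (ii), Φ is expressed through its trace T. Since F² is
constant along the spray and along horizontal directions, d_J F² annihilates the image of Φ
(`fderiv_jacobiMap_eq_zero`), which forces F² d_J T = T d_J F². Then Φ is isotropic with κ =
T/((n−1)F²), and d_Jκ = 0 (`flagCurvature_of_weylType_eq_zero`).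

What remains is Schur's lemma. When d_Jκ = 0, the vertical derivative of Φ determines the curvature
of the nonlinear connection, and the Bianchi identity becomes a cyclic relation on dκ
(`schur_cyclic`), which forces dκ = 0 when n ≥ 3 (`schur`). Each chart yields its own κ. Since Φ is
a tensor (`jacobiMap_change`), these agree on overlaps (`isotropic_unique`), so they define a
locally constant function on the connected manifold M. -/

noncomputable section

namespace FinslerGeom

/-! ### Symmetry and evaluation rules for iterated derivatives. -/

section Calculus

variable {E F : Type*} [NormedAddCommGroup E] [NormedSpace ℝ E]
  [NormedAddCommGroup F] [NormedSpace ℝ F]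

theorem contDiffAt_fderiv {f : E → F} {p : E} (hf : ContDiffAt ℝ ∞ f p) :
    ContDiffAt ℝ ∞ (fderiv ℝ f) p :=
  hf.fderiv_right (by simp)

theorem differentiableAt_of_smooth {f : E → F} {p : E} (hf : ContDiffAt ℝ ∞ f p) :
    DifferentiableAt ℝ f p :=
  hf.differentiableAt (by simp)

theorem differentiableAt_fderiv {f : E → F} {p : E} (hf : ContDiffAt ℝ ∞ f p) :
    DifferentiableAt ℝ (fderiv ℝ f) p :=
  differentiableAt_of_smooth (contDiffAt_fderiv hf)

theorem snd_fderiv_symm {f : E → F} {p : E} (hf : ContDiffAt ℝ ∞ f p) (a b : E) :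
    fderiv ℝ (fderiv ℝ f) p a b = fderiv ℝ (fderiv ℝ f) p b a :=
  (hf.isSymmSndFDerivAt (by rw [minSmoothness_of_isRCLikeNormedField]; norm_cast)).eq a b

theorem fderiv_fderiv_apply {f : E → F} {p : E} (hf : ContDiffAt ℝ ∞ f p) {X : E → E}
    (hX : DifferentiableAt ℝ X p) (a : E) :
    fderiv ℝ (fun q => fderiv ℝ f q (X q)) p a =
      fderiv ℝ (fderiv ℝ f) p a (X p) + fderiv ℝ f p (fderiv ℝ X p a) := by
  rw [fderiv_clm_apply (differentiableAt_fderiv hf) hX]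
  simp [add_comm]

theorem fderiv_fderiv_apply_const {f : E → F} {p : E} (hf : ContDiffAt ℝ ∞ f p) (b a : E) :
    fderiv ℝ (fun q => fderiv ℝ f q b) p a = fderiv ℝ (fderiv ℝ f) p a b := by
  rw [fderiv_fderiv_apply hf (differentiableAt_const b)]
  simp

theorem contDiffAt_fderiv_apply {f : E → F} {p : E} (hf : ContDiffAt ℝ ∞ f p) {X : E → E}
    (hX : ContDiffAt ℝ ∞ X p) : ContDiffAt ℝ ∞ (fun q => fderiv ℝ f q (X q)) p :=
  (contDiffAt_fderiv hf).clm_apply hX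

/-- The third derivative is symmetric in its last two arguments. -/
theorem trd_fderiv_symm {f : E → F} {p : E} (hf : ContDiffAt ℝ ∞ f p) (a b c : E) :
    fderiv ℝ (fderiv ℝ (fderiv ℝ f)) p a b c = fderiv ℝ (fderiv ℝ (fderiv ℝ f)) p a c b := by
  have hev : ∀ b c : E, fderiv ℝ (fun q => fderiv ℝ (fderiv ℝ f) q b c) p a =
      fderiv ℝ (fderiv ℝ (fderiv ℝ f)) p a b c := by
    intro b c
    have h1 := differentiableAt_fderiv (contDiffAt_fderiv hf)
    rw [fderiv_clm_apply (h1.clm_apply (differentiableAt_const b)) (differentiableAt_const c),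
      fderiv_clm_apply h1 (differentiableAt_const b)]
    simp
  rw [← hev b c, ← hev c b]
  have : (fun q => fderiv ℝ (fderiv ℝ f) q b c) =ᶠ[nhds p]
      fun q => fderiv ℝ (fderiv ℝ f) q c b := by
    -- Only finite-order smoothness at a point spreads to a neighbourhood; order 2 is what symmetry
    -- of the Hessian needs.
    have h2 : ContDiffAt ℝ 2 f p := hf.of_le (by norm_cast)
    filter_upwards [h2.eventually (by simp)] with q hq
    exact (hq.isSymmSndFDerivAt (by simp)).eq b c
  rw [this.fderiv_eq]

end Calculus

/-! ### Coordinate-free calculus of sprays: first integrals, curvature, Bianchi identity. -/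

section Spray

variable {E : Type*} [NormedAddCommGroup E] [NormedSpace ℝ E]

/-- The spray `S = y ∂/∂x - 2 G ∂/∂y` as a vector field. -/
def sprayField (G : E × E → E) (p : E × E) : E × E := (p.2, -(2 : ℝ) • G p)

/-- The Jacobi endomorphism of the spray with coefficients `G`. -/
def jacobiMap (G : E × E → E) (p : E × E) (v : E) : E :=
  (2 : ℝ) • fderiv ℝ G p (v, 0) - fderiv ℝ (fderiv ℝ G) p (sprayField G p) (0, v)
    - fderiv ℝ G p (0, fderiv ℝ G p (0, v))

/-- The horizontal lift of `v`. -/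
def hlift (G : E × E → E) (v : E) (p : E × E) : E × E := (v, -fderiv ℝ G p (0, v))

/-- The curvature of the nonlinear connection of the spray. -/
def connCurv (G : E × E → E) (p : E × E) (v w : E) : E :=
  fderiv ℝ (fderiv ℝ G) p (hlift G v p) (0, w) - fderiv ℝ (fderiv ℝ G) p (hlift G w p) (0, v)

/-- `G` are the coefficients of the geodesic spray of the regular, `2`-homogeneous Lagrangian `L`
on the open set `U`. -/
structure IsGeodesicSpray (L : E × E → ℝ) (G : E × E → E) (U : Set (E × E)) : Prop where
  isOpen : IsOpen U
  smoothL : ∀ p ∈ U, ContDiffAt ℝ ∞ L p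
  smoothG : ∀ p ∈ U, ContDiffAt ℝ ∞ G p
  euler : ∀ p ∈ U, fderiv ℝ L p (0, p.2) = 2 * L p
  eulerLagrange : ∀ p ∈ U, ∀ v,
    fderiv ℝ (fderiv ℝ L) p (sprayField G p) (0, v) = fderiv ℝ L p (v, 0)

theorem pair_split {W : Type*} [AddCommGroup W] [Module ℝ W] [TopologicalSpace W]
    (A : E × E →L[ℝ] W) (a b : E) : A (a, b) = A (a, 0) + A (0, b) := by
  rw [← map_add]; simp

theorem hasFDerivAt_sprayField {G : E × E → E} {p : E × E} (hG : ContDiffAt ℝ ∞ G p) :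
    HasFDerivAt (sprayField G)
      ((ContinuousLinearMap.snd ℝ E E).prod (-(2 : ℝ) • fderiv ℝ G p)) p :=
  hasFDerivAt_snd.prodMk ((differentiableAt_of_smooth hG).hasFDerivAt.const_smul (-(2 : ℝ)))

theorem fderiv_sprayField {G : E × E → E} {p : E × E} (hG : ContDiffAt ℝ ∞ G p) (a : E × E) :
    fderiv ℝ (sprayField G) p a = (a.2, -(2 : ℝ) • fderiv ℝ G p a) := by
  rw [(hasFDerivAt_sprayField hG).fderiv]; rfl

theorem hasFDerivAt_hlift {G : E × E → E} {p : E × E} (hG : ContDiffAt ℝ ∞ G p) (v : E) :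
    HasFDerivAt (hlift G v)
      ((0 : E × E →L[ℝ] E).prod (-(fderiv ℝ (fun q => fderiv ℝ G q (0, v)) p))) p :=
  (hasFDerivAt_const v p).prodMk (differentiableAt_of_smooth
    (contDiffAt_fderiv_apply hG contDiffAt_const)).hasFDerivAt.neg

theorem fderiv_hlift {G : E × E → E} {p : E × E} (hG : ContDiffAt ℝ ∞ G p) (v : E) (a : E × E) :
    fderiv ℝ (hlift G v) p a = (0, -(fderiv ℝ (fderiv ℝ G) p a (0, v))) := by
  rw [(hasFDerivAt_hlift hG v).fderiv, ← fderiv_fderiv_apply_const hG]; rfl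

theorem fderiv_vertical {p : E × E} {X : E × E → E} (hX : DifferentiableAt ℝ X p) (a : E × E) :
    fderiv ℝ (fun q => ((0 : E), X q)) p a = (0, fderiv ℝ X p a) := by
  have := ((hasFDerivAt_const (0 : E) p).prodMk hX.hasFDerivAt).fderiv
  rw [this]; rfl

namespace IsGeodesicSpray

variable {L : E × E → ℝ} {G : E × E → E} {U : Set (E × E)} (h : IsGeodesicSpray L G U)
  {p : E × E}

include h

theorem fderiv_congr_on {W : Type*} [NormedAddCommGroup W] [NormedSpace ℝ W] {f g : E × E → W}
    (hp : p ∈ U) (hfg : ∀ q ∈ U, f q = g q) : fderiv ℝ f p = fderiv ℝ g p :=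
  Filter.EventuallyEq.fderiv_eq (Filter.eventuallyEq_of_mem (h.isOpen.mem_nhds hp) hfg)

/-- The Lagrangian is a first integral of its geodesic spray. -/
theorem fderiv_sprayField_eq_zero (hp : p ∈ U) : fderiv ℝ L p (sprayField G p) = 0 := by
  -- Differentiating Euler's identity along S and using Euler–Lagrange gives S(L) = 2 S(L).
  have h1 := congrArg (fun A => A (sprayField G p)) (h.fderiv_congr_on hp h.euler)
  rw [fderiv_fderiv_apply (h.smoothL p hp) (by fun_prop), fderiv_vertical (by fun_prop),
    fderiv_const_mul (differentiableAt_of_smooth (h.smoothL p hp)), h.eulerLagrange p hp] at h1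
  have h2 : fderiv ℝ (fun q : E × E => q.2) p (sprayField G p) = (sprayField G p).2 := by
    rw [fderiv_snd]; rfl
  rw [h2] at h1
  have h3 := pair_split (fderiv ℝ L p) p.2 (sprayField G p).2
  change fderiv ℝ L p (sprayField G p) = _ at h3
  simp only [smul_apply, smul_eq_mul] at h1
  linarith

/-- The Lagrangian is constant along horizontal directions. -/
theorem fderiv_horizontal (hp : p ∈ U) (v : E) :
    fderiv ℝ L p (v, 0) = fderiv ℝ L p (0, fderiv ℝ G p (0, v)) := by
  -- This is the vertical derivative of S(L) = 0.
  have h1 := congrArg (fun A => A (0, v)) (h.fderiv_congr_on (g := fun _ => (0 : ℝ)) hp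
    fun q hq => h.fderiv_sprayField_eq_zero hq)
  rw [fderiv_fderiv_apply (h.smoothL p hp)
    (hasFDerivAt_sprayField (h.smoothG p hp)).differentiableAt, fderiv_sprayField (h.smoothG p hp),
    snd_fderiv_symm (h.smoothL p hp), h.eulerLagrange p hp] at h1
  have h0 := pair_split (fderiv ℝ L p) v (-(2 : ℝ) • fderiv ℝ G p (0, v))
  have h2 : ((0 : E), -(2 : ℝ) • fderiv ℝ G p (0, v)) =
    -(2 : ℝ) • ((0 : E), fderiv ℝ G p (0, v)) := by simp
  rw [h2, map_smul] at h0
  simp only [h0, smul_eq_mul, fderiv_fun_const, Pi.zero_apply, zero_apply] at h1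
  linarith

/-- Differentiate S(L) = 0 in the direction (v, 0), and the horizontal constancy of L along S. Both
contain the Hessian of L on S and (v, 0); eliminating it leaves exactly the three terms of Φ. This
is what lets W₀ = 0 determine d_J of the trace. -/
theorem fderiv_jacobiMap_eq_zero (hp : p ∈ U) (v : E) :
    fderiv ℝ L p (0, jacobiMap G p v) = 0 := by
  have hL := h.smoothL p hp
  have hG := h.smoothG p hp
  have hN : ContDiffAt ℝ ∞ (fun q => fderiv ℝ G q (0, v)) p :=
    contDiffAt_fderiv_apply hG contDiffAt_const
  have h1 := congrArg (fun A => A (v, 0)) (h.fderiv_congr_on (g := fun _ => (0 : ℝ)) hp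
    fun q hq => h.fderiv_sprayField_eq_zero hq)
  have h2 := congrArg (fun A => A (sprayField G p)) (h.fderiv_congr_on hp
    fun q hq => h.fderiv_horizontal hq v)
  rw [fderiv_fderiv_apply hL (hasFDerivAt_sprayField hG).differentiableAt,
    fderiv_sprayField hG, snd_fderiv_symm hL] at h1
  rw [fderiv_fderiv_apply_const hL,
    fderiv_fderiv_apply hL ((differentiableAt_const _).prodMk (differentiableAt_of_smooth hN)),
    fderiv_vertical (differentiableAt_of_smooth hN), h.eulerLagrange p hp,
    h.fderiv_horizontal hp, fderiv_fderiv_apply_const hG] at h2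
  have h3 : ((0 : E), jacobiMap G p v) = -((v, (0 : E)).2, -(2 : ℝ) • fderiv ℝ G p (v, 0))
      - (0, fderiv ℝ (fderiv ℝ G) p (sprayField G p) (0, v))
      - (0, fderiv ℝ G p (0, fderiv ℝ G p (0, v))) := by
    simp [jacobiMap]
  rw [h3, map_sub, map_sub, map_neg]
  simp only [fderiv_fun_const, Pi.zero_apply, zero_apply] at h1
  linarith

end IsGeodesicSpray

/-- The antisymmetrized vertical derivative of the Jacobi endomorphism. -/
theorem fderiv_jacobiMap_antisymm {G : E × E → E} {p : E × E} (hG : ContDiffAt ℝ ∞ G p)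
    (v w : E) :
    fderiv ℝ (fun q => jacobiMap G q w) p (0, v) - fderiv ℝ (fun q => jacobiMap G q v) p (0, w) =
      -(3 : ℝ) • connCurv G p v w := by
  have key : ∀ v w : E, fderiv ℝ (fun q => jacobiMap G q w) p (0, v) =
      (2 : ℝ) • fderiv ℝ (fderiv ℝ G) p (0, v) (w, 0)
      - (fderiv ℝ (fderiv ℝ (fderiv ℝ G)) p (0, v) (sprayField G p) (0, w)
        + fderiv ℝ (fderiv ℝ G) p (v, -(2 : ℝ) • fderiv ℝ G p (0, v)) (0, w))
      - (fderiv ℝ (fderiv ℝ G) p (0, v) (0, fderiv ℝ G p (0, w))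
        + fderiv ℝ G p (0, fderiv ℝ (fderiv ℝ G) p (0, v) (0, w))) := by
    intro v w
    have hN : DifferentiableAt ℝ (fun q => fderiv ℝ G q (0, w)) p :=
      differentiableAt_of_smooth (contDiffAt_fderiv_apply hG contDiffAt_const)
    have hS := (hasFDerivAt_sprayField hG).differentiableAt
    have d1 : DifferentiableAt ℝ (fun q => fderiv ℝ G q (w, 0)) p :=
      differentiableAt_of_smooth (contDiffAt_fderiv_apply hG contDiffAt_const)
    have d2' : DifferentiableAt ℝ (fun q => fderiv ℝ (fderiv ℝ G) q (sprayField G q)) p :=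
      (differentiableAt_fderiv (contDiffAt_fderiv hG)).clm_apply hS
    have d2 : DifferentiableAt ℝ
        (fun q => fderiv ℝ (fderiv ℝ G) q (sprayField G q) (0, w)) p :=
      d2'.clm_apply (differentiableAt_const _)
    have dV : DifferentiableAt ℝ (fun q => ((0 : E), fderiv ℝ G q (0, w))) p :=
      (differentiableAt_const _).prodMk hN
    have d3 : DifferentiableAt ℝ (fun q => fderiv ℝ G q (0, fderiv ℝ G q (0, w))) p :=
      (differentiableAt_fderiv hG).clm_apply dV
    unfold jacobiMap
    rw [fderiv_fun_sub ((d1.fun_const_smul (2 : ℝ)).fun_sub d2) d3,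
      fderiv_fun_sub (d1.fun_const_smul (2 : ℝ)) d2, fderiv_fun_const_smul d1,
      fderiv_clm_apply d2' (differentiableAt_const _)]
    simp only [sub_apply, smul_apply,
      add_apply]
    rw [fderiv_fderiv_apply_const hG, fderiv_fderiv_apply hG dV, fderiv_vertical hN,
      fderiv_fderiv_apply_const hG]
    simp only [ContinuousLinearMap.comp_apply, ContinuousLinearMap.flip_apply,
      fderiv_fun_const, Pi.zero_apply, zero_apply, map_zero, zero_add]
    rw [fderiv_fderiv_apply (contDiffAt_fderiv hG) hS, fderiv_sprayField hG]
    simp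
  -- The third-order terms are symmetric in v and w, so they drop out. Of the factor −3, two units
  -- come from 2 ∂G/∂x and one from differentiating S inside S(∂G/∂y).
  have t : fderiv ℝ (fderiv ℝ (fderiv ℝ G)) p (0, v) (sprayField G p) (0, w) =
      fderiv ℝ (fderiv ℝ (fderiv ℝ G)) p (0, w) (sprayField G p) (0, v) := by
    rw [snd_fderiv_symm (contDiffAt_fderiv hG), trd_fderiv_symm hG,
      snd_fderiv_symm (contDiffAt_fderiv hG)]
  have e : ∀ v : E, ((v, -(2 : ℝ) • fderiv ℝ G p (0, v)) : E × E) =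
      hlift G v p - (0, fderiv ℝ G p (0, v)) := by
    intro v; ext
    · simp [hlift]
    · simp only [hlift, Prod.snd_sub]; module
  have e' : ∀ v : E, ((v, 0) : E × E) = hlift G v p + (0, fderiv ℝ G p (0, v)) := by
    intro v; ext <;> simp [hlift]
  rw [key v w, key w v, t, e v, e w, e' v, e' w, snd_fderiv_symm hG (0, w) (0, v),
    snd_fderiv_symm hG (0, v) (hlift G w p + _), snd_fderiv_symm hG (0, w) (hlift G v p + _),
    snd_fderiv_symm hG (0, v) (0, fderiv ℝ G p (0, w)),
    snd_fderiv_symm hG (0, w) (0, fderiv ℝ G p (0, v))]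
  simp only [connCurv, map_add, map_sub, add_apply,
    sub_apply]
  module

/-- The commutator of two horizontal derivatives is the vertical derivative along the curvature. -/
theorem horizontal_commutator {W : Type*} [NormedAddCommGroup W] [NormedSpace ℝ W]
    {G : E × E → E} {f : E × E → W} {p : E × E} (hG : ContDiffAt ℝ ∞ G p)
    (hf : ContDiffAt ℝ ∞ f p) (u v : E) :
    fderiv ℝ (fun q => fderiv ℝ f q (hlift G v q)) p (hlift G u p)
      - fderiv ℝ (fun q => fderiv ℝ f q (hlift G u q)) p (hlift G v p) =
      -fderiv ℝ f p (0, connCurv G p u v) := by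
  rw [fderiv_fderiv_apply hf (hasFDerivAt_hlift hG v).differentiableAt,
    fderiv_fderiv_apply hf (hasFDerivAt_hlift hG u).differentiableAt, fderiv_hlift hG,
    fderiv_hlift hG, snd_fderiv_symm hf]
  have : ((0 : E), connCurv G p u v) =
      -(0, -(fderiv ℝ (fderiv ℝ G) p (hlift G u p) (0, v)))
      + (0, -(fderiv ℝ (fderiv ℝ G) p (hlift G v p) (0, u))) := by
    simp [connCurv, sub_eq_add_neg]
  rw [this, map_add, map_neg]
  abel

/-- The Bianchi identity for the curvature of the nonlinear connection of a spray. -/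
theorem bianchi {G : E × E → E} {p : E × E} (hG : ContDiffAt ℝ ∞ G p) (u v w : E) :
    (fderiv ℝ (fun q => connCurv G q v w) p (hlift G u p)
        + fderiv ℝ (fderiv ℝ G) p (0, connCurv G p v w) (0, u))
      + (fderiv ℝ (fun q => connCurv G q w u) p (hlift G v p)
        + fderiv ℝ (fderiv ℝ G) p (0, connCurv G p w u) (0, v))
      + (fderiv ℝ (fun q => connCurv G q u v) p (hlift G w p)
        + fderiv ℝ (fderiv ℝ G) p (0, connCurv G p u v) (0, w)) = 0 := by
  have dd : ∀ a b : E, DifferentiableAt ℝ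
      (fun q => fderiv ℝ (fderiv ℝ G) q (hlift G a q) (0, b)) p := fun a b =>
    ((differentiableAt_fderiv (contDiffAt_fderiv hG)).clm_apply
      (hasFDerivAt_hlift hG a).differentiableAt).clm_apply (differentiableAt_const _)
  have hev : ∀ᶠ q in nhds p, DifferentiableAt ℝ (fderiv ℝ G) q := by
    have h2 : ContDiffAt ℝ 2 G p := hG.of_le (by norm_cast)
    filter_upwards [h2.eventually (by simp)] with q hq
    exact (hq.fderiv_right (m := 1) (by norm_num)).differentiableAt (by simp)
  have comm : ∀ a b c : E,
      fderiv ℝ (fun q => fderiv ℝ (fderiv ℝ G) q (hlift G b q) (0, c)) p (hlift G a p)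
      - fderiv ℝ (fun q => fderiv ℝ (fderiv ℝ G) q (hlift G a q) (0, c)) p (hlift G b p) =
      -fderiv ℝ (fderiv ℝ G) p (0, connCurv G p a b) (0, c) := by
    -- The commutator formula is applied to the connection itself, f = DG(0, c), whose horizontal
    -- derivatives are the building blocks of `connCurv`.
    intro a b c
    have := horizontal_commutator (f := fun q => fderiv ℝ G q (0, c)) hG
      (contDiffAt_fderiv_apply hG contDiffAt_const) a b
    rw [fderiv_fderiv_apply_const hG] at this
    rw [← this]
    have e : ∀ b : E, fderiv ℝ (fun q => fderiv ℝ (fderiv ℝ G) q (hlift G b q) (0, c)) p =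
        fderiv ℝ (fun q => fderiv ℝ (fun q => fderiv ℝ G q (0, c)) q (hlift G b q)) p := by
      intro b
      refine Filter.EventuallyEq.fderiv_eq ?_
      filter_upwards [hev] with q hq
      rw [fderiv_clm_apply hq (differentiableAt_const _)]
      simp
    rw [e, e]
  have expand : ∀ a b : E, fderiv ℝ (fun q => connCurv G q a b) p =
      fderiv ℝ (fun q => fderiv ℝ (fderiv ℝ G) q (hlift G a q) (0, b)) p
      - fderiv ℝ (fun q => fderiv ℝ (fderiv ℝ G) q (hlift G b q) (0, a)) p := fun a b =>
    fderiv_fun_sub (dd a b) (dd b a)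
  rw [expand, expand, expand]
  simp only [sub_apply]
  have c1 := comm u v w
  have c2 := comm v w u
  have c3 := comm w u v
  have := congrArg₂ (· + ·) (congrArg₂ (· + ·) c1 c2) c3
  refine Eq.trans ?_ (sub_eq_zero.mpr this)
  abel

end Spray

/-! ### Schur's lemma on a coordinate domain. -/

section Schur

variable {E : Type*} [NormedAddCommGroup E] [NormedSpace ℝ E]

/-- `Φ = κ (L J - θ ⊗ C)` on `U`, where `θ = ½ d_J L`, for the Jacobi endomorphism `Φ` of the
spray with coefficients `G`. -/
def IsIsotropicOn (L : E × E → ℝ) (G : E × E → E) (κ : E × E → ℝ) (U : Set (E × E)) : Prop :=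
  ∀ p ∈ U, ∀ v, jacobiMap G p v =
    κ p • (L p • v - ((1 / 2 : ℝ) * fderiv ℝ L p (0, v)) • p.2)

/-- A function with vanishing vertical derivative is constant on the slit fibres. -/
theorem eq_of_vertical_fderiv_eq_zero {κ : E × E → ℝ} (hdim : 1 < Module.rank ℝ E) {V : Set E}
    (hκ : ∀ q ∈ V ×ˢ ({0}ᶜ : Set E), DifferentiableAt ℝ κ q)
    (hvert : ∀ q ∈ V ×ˢ ({0}ᶜ : Set E), ∀ v, fderiv ℝ κ q (0, v) = 0) {x y z : E} (hx : x ∈ V)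
    (hy : y ≠ 0) (hz : z ≠ 0) : κ (x, y) = κ (x, z) := by
  have hd : ∀ y ∈ ({0}ᶜ : Set E), HasFDerivAt (fun y => κ (x, y))
      ((fderiv ℝ κ (x, y)).comp (ContinuousLinearMap.inr ℝ E E)) y := fun y hy =>
    (hκ (x, y) ⟨hx, hy⟩).hasFDerivAt.comp y (hasFDerivAt_prodMk_right x y)
  refine isOpen_compl_singleton.is_const_of_fderiv_eq_zero
    (isConnected_compl_singleton_of_one_lt_rank hdim 0).isPreconnected
    (f := fun y => κ (x, y)) (𝕜 := ℝ)
    (fun y hy => (hd y hy).differentiableAt.differentiableWithinAt) (fun y hy => ?_) hy hz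
  rw [(hd y hy).fderiv]
  ext v
  exact hvert (x, y) ⟨hx, hy⟩ v

theorem exists_mem_not_mem_span {K : Submodule ℝ E} (hK : 2 ≤ Module.finrank ℝ K) (y : E) :
    ∃ v ∈ K, v ∉ Submodule.span ℝ {y} := by
  by_contra! hle
  have h1 : Module.finrank ℝ K ≤ Module.finrank ℝ (Submodule.span ℝ {y}) :=
    Submodule.finrank_mono hle
  have h2 := finrank_span_le_card (R := ℝ) ({y} : Set E)
  simp only [Set.toFinset_card, Fintype.card_unique] at h2
  omega

theorem mem_span_of_smul_eq {c d : ℝ} {v y : E} (hc : c ≠ 0) (hv : c • v = d • y) :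
    v ∈ Submodule.span ℝ {y} :=
  Submodule.mem_span_singleton.2 ⟨c⁻¹ * d, by rw [mul_smul, ← hv, inv_smul_smul₀ hc]⟩

namespace IsGeodesicSpray

variable {L : E × E → ℝ} {G : E × E → E} {U : Set (E × E)} (h : IsGeodesicSpray L G U)
  {p : E × E} {κ : E × E → ℝ}

include h

theorem fderiv_isotropic (hκ : ∀ q ∈ U, DifferentiableAt ℝ κ q) (hΦ : IsIsotropicOn L G κ U)
    (hvert : ∀ q ∈ U, ∀ v, fderiv ℝ κ q (0, v) = 0) (hp : p ∈ U) (v w : E) :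
    fderiv ℝ (fun q => jacobiMap G q w) p (0, v) =
      κ p • (fderiv ℝ L p (0, v) • w
        - ((1 / 2 : ℝ) * fderiv ℝ (fderiv ℝ L) p (0, v) (0, w)) • p.2
        - ((1 / 2 : ℝ) * fderiv ℝ L p (0, w)) • v) := by
  have hL := h.smoothL p hp
  have dL := differentiableAt_of_smooth hL
  have dθ : DifferentiableAt ℝ (fun q => (1 / 2 : ℝ) * fderiv ℝ L q (0, w)) p :=
    (differentiableAt_of_smooth (contDiffAt_fderiv_apply hL contDiffAt_const)).const_mul _
  have e1 := dL.hasFDerivAt.smul_const w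
  have e2 := dθ.hasFDerivAt.smul (hasFDerivAt_snd (𝕜 := ℝ) (p := p))
  have e3 := (hκ p hp).hasFDerivAt.smul (e1.sub e2)
  rw [h.fderiv_congr_on hp fun q hq => hΦ q hq w]
  refine (DFunLike.congr_fun e3.fderiv (0, v)).trans ?_
  have e4 : fderiv ℝ (fun q => (1 / 2 : ℝ) * fderiv ℝ L q (0, w)) p (0, v) =
      (1 / 2 : ℝ) * fderiv ℝ (fderiv ℝ L) p (0, v) (0, w) := by
    rw [fderiv_const_mul (differentiableAt_of_smooth
      (contDiffAt_fderiv_apply hL contDiffAt_const)), smul_apply, fderiv_fderiv_apply_const hL]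
    rfl
  simp only [add_apply, smul_apply, ContinuousLinearMap.smulRight_apply, sub_apply, e4,
    hvert p hp v, ContinuousLinearMap.coe_snd']
  module

/-- Antisymmetrizing the vertical derivative of Φ recovers −3 times the curvature. The Hessian of L
cancels by symmetry, and no derivative of κ appears because κ is vertically constant. -/
theorem connCurv_isotropic (hκ : ∀ q ∈ U, DifferentiableAt ℝ κ q) (hΦ : IsIsotropicOn L G κ U)
    (hvert : ∀ q ∈ U, ∀ v, fderiv ℝ κ q (0, v) = 0) (hp : p ∈ U) (v w : E) :
    connCurv G p v w = κ p • (((1 / 2 : ℝ) * fderiv ℝ L p (0, w)) • v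
      - ((1 / 2 : ℝ) * fderiv ℝ L p (0, v)) • w) := by
  have h1 := fderiv_jacobiMap_antisymm (h.smoothG p hp) v w
  rw [h.fderiv_isotropic hκ hΦ hvert hp, h.fderiv_isotropic hκ hΦ hvert hp,
    snd_fderiv_symm (h.smoothL p hp) (0, w) (0, v)] at h1
  have h2 : connCurv G p v w = -(1 / 3 : ℝ) • (-(3 : ℝ) • connCurv G p v w) := by module
  rw [h2, ← h1]
  module

/-- Differentiating the horizontal constancy of L vertically shows that d_J L is parallel along
horizontal directions for the Berwald connection, whose coefficients are the vertical Hessian of G.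
-/
theorem fderiv_horizontal_vertical (hp : p ∈ U) (u w : E) :
    fderiv ℝ (fderiv ℝ L) p (hlift G u p) (0, w) =
      fderiv ℝ L p (0, fderiv ℝ (fderiv ℝ G) p (0, w) (0, u)) := by
  have hL := h.smoothL p hp
  have hG := h.smoothG p hp
  have hN : DifferentiableAt ℝ (fun q => fderiv ℝ G q (0, u)) p :=
    differentiableAt_of_smooth (contDiffAt_fderiv_apply hG contDiffAt_const)
  have h1 := DFunLike.congr_fun (h.fderiv_congr_on hp fun q hq => h.fderiv_horizontal hq u)
    ((0 : E), w)
  rw [fderiv_fderiv_apply_const hL, fderiv_fderiv_apply hL ((differentiableAt_const _).prodMk hN),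
    fderiv_vertical hN, fderiv_fderiv_apply_const hG] at h1
  have h2 : hlift G u p = (u, 0) - (0, fderiv ℝ G p (0, u)) := by simp [hlift]
  rw [snd_fderiv_symm hL, h2, map_sub, h1]
  simp

/-- Substitute the isotropic form of the curvature into the Bianchi identity. Every term carrying κ
undifferentiated involves the vertical Hessian of G, which is symmetric, so these terms cancel in
the cyclic sum and only dκ survives. -/
theorem schur_cyclic (hκ : ∀ q ∈ U, DifferentiableAt ℝ κ q) (hΦ : IsIsotropicOn L G κ U)
    (hvert : ∀ q ∈ U, ∀ v, fderiv ℝ κ q (0, v) = 0) (hp : p ∈ U) (u v w : E) :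
    fderiv ℝ κ p (u, 0) • (fderiv ℝ L p (0, w) • v - fderiv ℝ L p (0, v) • w)
      + fderiv ℝ κ p (v, 0) • (fderiv ℝ L p (0, u) • w - fderiv ℝ L p (0, w) • u)
      + fderiv ℝ κ p (w, 0) • (fderiv ℝ L p (0, v) • u - fderiv ℝ L p (0, u) • v) = 0 := by
  have hL := h.smoothL p hp
  have hG := h.smoothG p hp
  have dθ : ∀ w, DifferentiableAt ℝ (fun q => (1 / 2 : ℝ) * fderiv ℝ L q (0, w)) p := fun w =>
    (differentiableAt_of_smooth (contDiffAt_fderiv_apply hL contDiffAt_const)).const_mul _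
  have e4 : ∀ u w, fderiv ℝ (fun q => (1 / 2 : ℝ) * fderiv ℝ L q (0, w)) p (hlift G u p) =
      (1 / 2 : ℝ) * fderiv ℝ L p (0, fderiv ℝ (fderiv ℝ G) p (0, w) (0, u)) := by
    intro u w
    rw [fderiv_const_mul (differentiableAt_of_smooth
      (contDiffAt_fderiv_apply hL contDiffAt_const)), smul_apply, fderiv_fderiv_apply_const hL,
      h.fderiv_horizontal_vertical hp]
    rfl
  have e5 : ∀ u, fderiv ℝ κ p (hlift G u p) = fderiv ℝ κ p (u, 0) := by
    intro u
    rw [hlift, pair_split, hvert p hp, add_zero]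
  have key : ∀ u v w : E, fderiv ℝ (fun q => connCurv G q v w) p (hlift G u p)
      + fderiv ℝ (fderiv ℝ G) p (0, connCurv G p v w) (0, u) =
      (1 / 2 : ℝ) • fderiv ℝ κ p (u, 0) • (fderiv ℝ L p (0, w) • v - fderiv ℝ L p (0, v) • w)
      + κ p • (((1 / 2 : ℝ) * fderiv ℝ L p (0, fderiv ℝ (fderiv ℝ G) p (0, w) (0, u))) • v
          - ((1 / 2 : ℝ) * fderiv ℝ L p (0, fderiv ℝ (fderiv ℝ G) p (0, v) (0, u))) • w
          + ((1 / 2 : ℝ) * fderiv ℝ L p (0, w)) • fderiv ℝ (fderiv ℝ G) p (0, v) (0, u)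
          - ((1 / 2 : ℝ) * fderiv ℝ L p (0, v)) • fderiv ℝ (fderiv ℝ G) p (0, w) (0, u)) := by
    intro u v w
    have e1 := (dθ w).hasFDerivAt.smul_const v
    have e2 := (dθ v).hasFDerivAt.smul_const w
    have e3 := (hκ p hp).hasFDerivAt.smul (e1.sub e2)
    have e6 := DFunLike.congr_fun e3.fderiv (hlift G u p)
    rw [h.fderiv_congr_on hp fun q hq => h.connCurv_isotropic hκ hΦ hvert hq v w]
    refine (congrArg₂ (· + ·) e6 rfl).trans ?_
    have e7 : ((0 : E), connCurv G p v w) = κ p • (((1 / 2 : ℝ) * fderiv ℝ L p (0, w)) • (0, v)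
        - ((1 / 2 : ℝ) * fderiv ℝ L p (0, v)) • (0, w)) := by
      rw [h.connCurv_isotropic hκ hΦ hvert hp]; simp
    rw [e7]
    simp only [add_apply, smul_apply, ContinuousLinearMap.smulRight_apply, sub_apply, map_smul,
      map_sub, e4, e5, Pi.sub_apply]
    module
  have hB := bianchi hG u v w
  rw [key u v w, key v w u, key w u v, snd_fderiv_symm hG (0, v) (0, u),
    snd_fderiv_symm hG (0, w) (0, v), snd_fderiv_symm hG (0, w) (0, u)] at hB
  refine Eq.trans ?_ ((congrArg ((2 : ℝ) • ·) hB).trans (smul_zero _))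
  module

/-- The Finsler version of Schur's lemma, on a coordinate domain. -/
theorem schur [FiniteDimensional ℝ E] (hdim : 3 ≤ Module.finrank ℝ E) {V : Set E}
    (hU : U = V ×ˢ {0}ᶜ) (hpos : ∀ q ∈ U, 0 < L q)
    (hκ : ∀ q ∈ U, DifferentiableAt ℝ κ q) (hΦ : IsIsotropicOn L G κ U)
    (hvert : ∀ q ∈ U, ∀ v, fderiv ℝ κ q (0, v) = 0) (hp : p ∈ U) : fderiv ℝ κ p = 0 := by
  have hx : p.1 ∈ V := by rw [hU] at hp; exact hp.1
  have hrank : 1 < Module.rank ℝ E := by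
    rw [← Module.finrank_eq_rank]; exact_mod_cast (by omega : 1 < Module.finrank ℝ E)
  by_contra hne
  set A : E →ₗ[ℝ] ℝ := ((fderiv ℝ κ p).comp (ContinuousLinearMap.inl ℝ E E)).toLinearMap with hA
  have hAu : ∃ u, A u ≠ 0 := by
    by_contra! h0
    apply hne
    ext v
    · exact h0 v
    · exact hvert p hp v
  obtain ⟨u, hu⟩ := hAu
  have hker : 2 ≤ Module.finrank ℝ (LinearMap.ker A) := by
    have h1 := A.finrank_range_add_finrank_ker
    have h2 := Submodule.finrank_le (LinearMap.range A)
    rw [Module.finrank_self] at h2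
    omega
  -- The span of 0 is trivial, so y is just a nonzero vector of the kernel. Since dim E ≥ 3, the
  -- kernel also contains some v independent of y.
  obtain ⟨y, hyK, hy⟩ := exists_mem_not_mem_span hker 0
  have hy0 : y ≠ 0 := by rintro rfl; exact hy (zero_mem _)
  obtain ⟨v, hvK, hv⟩ := exists_mem_not_mem_span hker y
  have hq : (p.1, y) ∈ U := by rw [hU]; exact ⟨hx, hy0⟩
  -- As κ is constant on slit fibres, its base differential is the same at (p.1, y) as at p; the
  -- direction can therefore be chosen inside the kernel.
  have hAq : ∀ w, fderiv ℝ κ (p.1, y) (w, 0) = A w := by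
    intro w
    have h1 : ∀ z : E, (p.1, z) ∈ U → fderiv ℝ (fun x => κ (x, z)) p.1 w =
        fderiv ℝ κ (p.1, z) (w, 0) := by
      intro z hz
      have : HasFDerivAt (fun x => κ (x, z))
          ((fderiv ℝ κ (p.1, z)).comp (ContinuousLinearMap.inl ℝ E E)) p.1 :=
        (hκ (p.1, z) hz).hasFDerivAt.comp p.1 (hasFDerivAt_prodMk_left p.1 z)
      exact DFunLike.congr_fun this.fderiv w
    rw [← h1 y hq, hA]
    refine Eq.trans ?_ (h1 p.2 hp)
    congr 1
    refine Filter.EventuallyEq.fderiv_eq ?_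
    have hc : ContinuousAt (fun x : E => (x, y)) p.1 := by fun_prop
    filter_upwards [hc.preimage_mem_nhds (h.isOpen.mem_nhds hq)] with x hx'
    subst hU
    exact eq_of_vertical_fderiv_eq_zero hrank hκ hvert hx'.1 hy0 hp.2
  -- With v and y in the kernel only the dκ(u) term remains. It makes dL(0, y) v a multiple of y,
  -- while dL(0, y) = 2L > 0.
  have hcyc := h.schur_cyclic hκ hΦ hvert hq u v y
  rw [hAq, hAq, hAq, LinearMap.mem_ker.1 hvK, LinearMap.mem_ker.1 hyK, zero_smul, zero_smul,
    add_zero, add_zero, smul_eq_zero, or_iff_right hu, sub_eq_zero] at hcyc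
  refine hv (mem_span_of_smul_eq (c := fderiv ℝ L (p.1, y) (0, y)) ?_ hcyc)
  rw [h.euler _ hq]
  have := hpos _ hq
  positivity

end IsGeodesicSpray

end Schur

/-! ### From index notation to invariant notation, and Finsler metrics in a chart. -/

section Coordinates

variable {n : ℕ}

theorem sum_smul_single (v : Coord n) : ∑ k, v k • EuclideanSpace.single k (1 : ℝ) = v := by
  ext i
  simp [Pi.single_apply]

theorem linear_eq_sum {W : Type*} [AddCommGroup W] [Module ℝ W] (A : Coord n →ₗ[ℝ] W)
    (v : Coord n) : A v = ∑ k, v k • A (EuclideanSpace.single k 1) := by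
  conv_lhs => rw [← sum_smul_single v, map_sum]
  simp

theorem fderiv_horizontal_eq_sum (f : Coord n × Coord n → ℝ) (p : Coord n × Coord n)
    (v : Coord n) : fderiv ℝ f p (v, 0) = ∑ k, v k * dx k f p :=
  linear_eq_sum ((fderiv ℝ f p).comp (ContinuousLinearMap.inl ℝ _ _)).toLinearMap v

theorem fderiv_vertical_eq_sum (f : Coord n × Coord n → ℝ) (p : Coord n × Coord n)
    (v : Coord n) : fderiv ℝ f p (0, v) = ∑ k, v k * dy k f p :=
  linear_eq_sum ((fderiv ℝ f p).comp (ContinuousLinearMap.inr ℝ _ _)).toLinearMap v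

theorem fderiv_coord {P : Type*} [NormedAddCommGroup P] [NormedSpace ℝ P] {G : P → Coord n}
    {p : P} (hG : DifferentiableAt ℝ G p) (i : Fin n) (a : P) :
    fderiv ℝ (fun q => G q i) p a = fderiv ℝ G p a i := by
  have : HasFDerivAt (fun q => G q i) ((EuclideanSpace.proj (𝕜 := ℝ) i).comp (fderiv ℝ G p)) p :=
    (EuclideanSpace.proj (𝕜 := ℝ) i).hasFDerivAt.comp p hG.hasFDerivAt
  rw [this.fderiv]; rfl

theorem sprayDeriv_eq_fderiv (G : Coord n × Coord n → Coord n) (f : Coord n × Coord n → ℝ)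
    (p : Coord n × Coord n) :
    sprayDeriv (fun i q => G q i) f p = fderiv ℝ f p (sprayField G p) := by
  rw [sprayField, pair_split, fderiv_horizontal_eq_sum, fderiv_vertical_eq_sum,
    ← Finset.sum_add_distrib]
  refine Finset.sum_congr rfl fun k _ => ?_
  simp
  ring

theorem jacobi_eq_jacobiMap {G : Coord n × Coord n → Coord n} {p : Coord n × Coord n}
    (hG : ContDiffAt ℝ ∞ G p) (i j : Fin n) :
    jacobi (fun i q => G q i) i j p = jacobiMap G p (EuclideanSpace.single j 1) i := by
  have hd := differentiableAt_of_smooth hG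
  have hev : ∀ᶠ q in nhds p, DifferentiableAt ℝ G q := by
    have h2 : ContDiffAt ℝ 1 G p := hG.of_le (by norm_cast)
    filter_upwards [h2.eventually (by simp)] with q hq
    exact hq.differentiableAt (by simp)
  have hN : DifferentiableAt ℝ (fun q => fderiv ℝ G q (0, EuclideanSpace.single j 1)) p :=
    differentiableAt_of_smooth (contDiffAt_fderiv_apply hG contDiffAt_const)
  have h1 : fderiv ℝ (dy j fun q => G q i) p =
      fderiv ℝ (fun q => fderiv ℝ G q (0, EuclideanSpace.single j 1) i) p := by
    refine Filter.EventuallyEq.fderiv_eq ?_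
    filter_upwards [hev] with q hq
    exact fderiv_coord hq i _
  rw [jacobi, sprayDeriv_eq_fderiv, h1, fderiv_coord hN, fderiv_fderiv_apply_const hG]
  have h2 : ∑ k, dy k (fun q => G q i) p * dy j (fun q => G q k) p =
      fderiv ℝ G p (0, fderiv ℝ G p (0, EuclideanSpace.single j 1)) i := by
    rw [← fderiv_coord hd, fderiv_vertical_eq_sum]
    refine Finset.sum_congr rfl fun k _ => ?_
    rw [mul_comm, dy, dy, fderiv_coord hd k]
  rw [h2, dx, fderiv_coord hd]
  simp [jacobiMap]

theorem contDiffAt_jacobiMap {E : Type*} [NormedAddCommGroup E] [NormedSpace ℝ E]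
    {G : E × E → E} {p : E × E} (hG : ContDiffAt ℝ ∞ G p) (v : E) :
    ContDiffAt ℝ ∞ (fun q => jacobiMap G q v) p := by
  have hN := contDiffAt_fderiv_apply hG (contDiffAt_const (c := ((0 : E), v)))
  have hS : ContDiffAt ℝ ∞ (sprayField G) p := contDiffAt_snd.prodMk (hG.const_smul (-(2 : ℝ)))
  exact ((contDiffAt_fderiv_apply hG contDiffAt_const).const_smul (2 : ℝ)).sub
    ((contDiffAt_fderiv_apply (contDiffAt_fderiv hG) hS).clm_apply contDiffAt_const)
    |>.sub (contDiffAt_fderiv_apply hG (contDiffAt_const.prodMk hN))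

/-- The Jacobi endomorphism as a linear map. -/
def jacobiLinear {E : Type*} [NormedAddCommGroup E] [NormedSpace ℝ E]
    (G : E × E → E) (p : E × E) : E →ₗ[ℝ] E :=
  ((2 : ℝ) • (fderiv ℝ G p).comp (ContinuousLinearMap.inl ℝ E E)
    - (fderiv ℝ (fderiv ℝ G) p (sprayField G p)).comp (ContinuousLinearMap.inr ℝ E E)
    - ((fderiv ℝ G p).comp (ContinuousLinearMap.inr ℝ E E)).comp
        ((fderiv ℝ G p).comp (ContinuousLinearMap.inr ℝ E E))).toLinearMap

theorem jacobiLinear_apply {E : Type*} [NormedAddCommGroup E] [NormedSpace ℝ E]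
    (G : E × E → E) (p : E × E) (v : E) : jacobiLinear G p v = jacobiMap G p v := by
  simp [jacobiLinear, jacobiMap]

theorem contDiffAt_det {P : Type*} [NormedAddCommGroup P] [NormedSpace ℝ P]
    {A : P → Matrix (Fin n) (Fin n) ℝ} {p : P} (hA : ∀ i j, ContDiffAt ℝ ∞ (fun q => A q i j) p) :
    ContDiffAt ℝ ∞ (fun q => (A q).det) p := by
  simp only [Matrix.det_apply]
  exact ContDiffAt.sum fun σ _ => (contDiffAt_prod fun i _ => hA _ _).const_smul _

/-- By Cramer's rule: each entry is a determinant of smooth entries divided by det A. This gives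
smoothness of the spray coefficients. -/
theorem contDiffAt_matrix_inv {P : Type*} [NormedAddCommGroup P] [NormedSpace ℝ P]
    {A : P → Matrix (Fin n) (Fin n) ℝ} {p : P} (hA : ∀ i j, ContDiffAt ℝ ∞ (fun q => A q i j) p)
    (hdet : (A p).det ≠ 0) (i j : Fin n) : ContDiffAt ℝ ∞ (fun q => (A q)⁻¹ i j) p := by
  simp only [Matrix.inv_def, Ring.inverse_eq_inv', Matrix.smul_apply, Matrix.adjugate_apply,
    smul_eq_mul]
  refine ((contDiffAt_det hA).inv hdet).mul (contDiffAt_det fun k l => ?_)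
  by_cases hk : k = j
  · subst hk
    simpa using contDiffAt_const
  · simpa [Matrix.updateRow_ne hk] using hA k l

/-- The coefficients of the geodesic spray as a vector. -/
def sprayVec (F : Coord n × Coord n → ℝ) (p : Coord n × Coord n) : Coord n :=
  WithLp.toLp 2 fun i => sprayCoeff F i p

/-- `F` is a Finsler metric on the coordinate domain `V`. -/
structure IsLocalFinsler (F : Coord n × Coord n → ℝ) (V : Set (Coord n)) : Prop where
  isOpen : IsOpen V
  smooth : ∀ p ∈ V ×ˢ ({0}ᶜ : Set (Coord n)), ContDiffAt ℝ ∞ F p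
  pos : ∀ p ∈ V ×ˢ ({0}ᶜ : Set (Coord n)), 0 < F p
  homogeneous : ∀ p ∈ V ×ˢ ({0}ᶜ : Set (Coord n)), ∀ c : ℝ, 0 < c → F (p.1, c • p.2) = c * F p
  posDef : ∀ p ∈ V ×ˢ ({0}ᶜ : Set (Coord n)), (metricTensor F p).PosDef

namespace IsLocalFinsler

variable {F : Coord n × Coord n → ℝ} {V : Set (Coord n)} (h : IsLocalFinsler F V)
  {p : Coord n × Coord n}

include h

theorem smooth_sq (hp : p ∈ V ×ˢ ({0}ᶜ : Set (Coord n))) :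
    ContDiffAt ℝ ∞ (fun q => F q ^ 2) p := (h.smooth p hp).pow 2

theorem smooth_sprayVec (hp : p ∈ V ×ˢ ({0}ᶜ : Set (Coord n))) :
    ContDiffAt ℝ ∞ (sprayVec F) p := by
  have hL := h.smooth_sq hp
  have hd : ∀ l, ContDiffAt ℝ ∞ (dy l fun q => F q ^ 2) p := fun l =>
    contDiffAt_fderiv_apply hL contDiffAt_const
  rw [contDiffAt_euclidean]
  intro i
  change ContDiffAt ℝ ∞ (fun q => sprayCoeff F i q) p
  unfold sprayCoeff
  refine contDiffAt_const.mul (ContDiffAt.sum fun l _ => ContDiffAt.mul ?_ (ContDiffAt.sub ?_ ?_))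
  · refine contDiffAt_matrix_inv (fun i j => ?_) (h.posDef p hp).det_pos.ne' i l
    exact contDiffAt_const.mul (contDiffAt_fderiv_apply (hd j) contDiffAt_const)
  · refine ContDiffAt.sum fun k _ => ContDiffAt.mul ?_
      (contDiffAt_fderiv_apply (hd l) contDiffAt_const)
    exact contDiffAt_euclidean.1 contDiffAt_snd k
  · exact contDiffAt_fderiv_apply hL contDiffAt_const

/-- Differentiate c ↦ F(x, c y)² = c² F(x, y)² at c = 1. -/
theorem euler_sq (hp : p ∈ V ×ˢ ({0}ᶜ : Set (Coord n))) :
    fderiv ℝ (fun q => F q ^ 2) p (0, p.2) = 2 * F p ^ 2 := by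
  have hL := differentiableAt_of_smooth (h.smooth_sq hp)
  have h1 : HasDerivAt (fun c : ℝ => (p.1, c • p.2)) ((0 : Coord n), p.2) 1 := by
    simpa using (hasDerivAt_const (1 : ℝ) p.1).prodMk ((hasDerivAt_id (1 : ℝ)).smul_const p.2)
  have hL' : HasFDerivAt (fun q => F q ^ 2) (fderiv ℝ (fun q => F q ^ 2) p)
      ((fun c : ℝ => (p.1, c • p.2)) 1) := by simpa using hL.hasFDerivAt
  have h2 := hL'.comp_hasDerivAt (1 : ℝ) h1
  have h3 : HasDerivAt (fun c : ℝ => c ^ 2 * F p ^ 2) (2 * F p ^ 2) 1 := by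
    simpa using ((hasDerivAt_id (1 : ℝ)).pow 2).mul_const (F p ^ 2)
  refine h2.unique (h3.congr_of_eventuallyEq ?_)
  filter_upwards [lt_mem_nhds (zero_lt_one' ℝ)] with c hc
  simp only [Function.comp_apply]
  rw [h.homogeneous p hp c hc, mul_pow]

theorem isGeodesicSpray :
    IsGeodesicSpray (fun q => F q ^ 2) (sprayVec F) (V ×ˢ ({0}ᶜ : Set (Coord n))) where
  isOpen := h.isOpen.prod isOpen_compl_singleton
  smoothL _ hp := h.smooth_sq hp
  smoothG _ hp := h.smooth_sprayVec hp
  euler _ hp := h.euler_sq hp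
  eulerLagrange p hp v := by
    have hL := h.smooth_sq hp
    have hbasis : ∀ l, fderiv ℝ (fderiv ℝ fun q => F q ^ 2) p (sprayField (sprayVec F) p)
        (0, EuclideanSpace.single l 1) = dx l (fun q => F q ^ 2) p := by
      intro l
      rw [← fderiv_fderiv_apply_const hL]
      change fderiv ℝ (dy l fun q => F q ^ 2) p (sprayField (sprayVec F) p) = _
      rw [sprayField, pair_split, fderiv_horizontal_eq_sum, fderiv_vertical_eq_sum]
      set b : Fin n → ℝ := fun l =>
        (∑ k, p.2 k * dx k (dy l fun q => F q ^ 2) p) - dx l (fun q => F q ^ 2) p with hb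
      have hG : ∀ k, (-(2 : ℝ) • sprayVec F p) k =
          -(1 / 2) * ((metricTensor F p)⁻¹.mulVec b) k := by
        intro k
        simp only [sprayVec, sprayCoeff, PiLp.smul_apply, smul_eq_mul, Matrix.mulVec, dotProduct]
        simp only [hb]
        ring
      have hdy : ∀ k, dy k (dy l fun q => F q ^ 2) p = 2 * metricTensor F p l k := by
        intro k
        have : dy k (dy l fun q => F q ^ 2) p = dy l (dy k fun q => F q ^ 2) p := by
          change fderiv ℝ (fun q => fderiv ℝ (fun q => F q ^ 2) q (0, _)) p (0, _) =
            fderiv ℝ (fun q => fderiv ℝ (fun q => F q ^ 2) q (0, _)) p (0, _)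
          rw [fderiv_fderiv_apply_const hL, fderiv_fderiv_apply_const hL, snd_fderiv_symm hL]
        rw [this]
        simp [metricTensor]
      -- Positive definiteness makes g invertible, so the explicit formula for G really solves the
      -- Euler–Lagrange equation.
      have hinv : (metricTensor F p).mulVec ((metricTensor F p)⁻¹.mulVec b) = b := by
        rw [Matrix.mulVec_mulVec, Matrix.mul_nonsing_inv _
          (h.posDef p hp).det_pos.ne'.isUnit, Matrix.one_mulVec]
      have hsum : ∑ k, (-(2 : ℝ) • sprayVec F p) k * dy k (dy l fun q => F q ^ 2) p = -b l := by
        rw [← congrFun hinv l, Matrix.mulVec, dotProduct, ← Finset.sum_neg_distrib]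
        refine Finset.sum_congr rfl fun k _ => ?_
        rw [hG, hdy]
        ring
      rw [hsum, hb]
      ring
    have e1 := linear_eq_sum ((fderiv ℝ (fderiv ℝ fun q => F q ^ 2) p
      (sprayField (sprayVec F) p)).comp (ContinuousLinearMap.inr ℝ _ _)).toLinearMap v
    refine e1.trans ?_
    rw [fderiv_horizontal_eq_sum]
    refine Finset.sum_congr rfl fun k _ => ?_
    exact congrArg (v k * ·) (hbasis k)

end IsLocalFinsler

end Coordinates

/-! ### The tensors W₀ and W of an isotropic spray in a chart. -/

section LocalWeyl

variable {n : ℕ}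

/-- `Φ = κ (F² J - F d_J F ⊗ C)` on the slit tangent bundle over the coordinate domain `V`. -/
def HasLocalFlagCurvature (F κ : Coord n × Coord n → ℝ) (V : Set (Coord n)) : Prop :=
  ∀ p ∈ V ×ˢ ({0}ᶜ : Set (Coord n)), ∀ i j, jacobi (sprayCoeff F) i j p =
    κ p * (F p ^ 2 * kron i j - F p * dy j F p * p.2 i)

namespace IsLocalFinsler

variable {F : Coord n × Coord n → ℝ} {V : Set (Coord n)} (h : IsLocalFinsler F V)
  {p : Coord n × Coord n} {κ : Coord n × Coord n → ℝ}

include h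

theorem fderiv_sq (hp : p ∈ V ×ˢ ({0}ᶜ : Set (Coord n))) (a : Coord n × Coord n) :
    fderiv ℝ (fun q => F q ^ 2) p a = 2 * F p * fderiv ℝ F p a := by
  rw [fderiv_fun_pow 2 (differentiableAt_of_smooth (h.smooth p hp))]
  simp

theorem euler (hp : p ∈ V ×ˢ ({0}ᶜ : Set (Coord n))) : fderiv ℝ F p (0, p.2) = F p := by
  have h1 := h.euler_sq hp
  rw [h.fderiv_sq hp] at h1
  have h2 := h.pos p hp
  have h3 : (2 * F p) * (fderiv ℝ F p (0, p.2) - F p) = 0 := by linarith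
  have := (mul_eq_zero.1 h3).resolve_left (by positivity)
  linarith

theorem jacobi_eq (hp : p ∈ V ×ˢ ({0}ᶜ : Set (Coord n))) (i j : Fin n) :
    jacobi (sprayCoeff F) i j p = jacobiMap (sprayVec F) p (EuclideanSpace.single j 1) i :=
  jacobi_eq_jacobiMap (h.smooth_sprayVec hp) i j

theorem smooth_jacobiTrace (hp : p ∈ V ×ˢ ({0}ᶜ : Set (Coord n))) :
    ContDiffAt ℝ ∞ (jacobiTrace (sprayCoeff F)) p := by
  have h1 : ContDiffAt ℝ ∞
      (fun q => ∑ l, jacobiMap (sprayVec F) q (EuclideanSpace.single l 1) l) p :=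
    ContDiffAt.sum fun l _ =>
      contDiffAt_euclidean.1 (contDiffAt_jacobiMap (h.smooth_sprayVec hp) _) l
  refine h1.congr_of_eventuallyEq ?_
  filter_upwards [h.isGeodesicSpray.isOpen.mem_nhds hp] with q hq
  exact Finset.sum_congr rfl fun l _ => h.jacobi_eq hq l l

theorem isIsotropicOn (hΦ : HasLocalFlagCurvature F κ V) :
    IsIsotropicOn (fun q => F q ^ 2) (sprayVec F) κ (V ×ˢ ({0}ᶜ : Set (Coord n))) := by
  intro p hp v
  set B : Coord n →ₗ[ℝ] Coord n := κ p • (F p ^ 2 • LinearMap.id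
    - ((1 / 2 : ℝ) • ((fderiv ℝ (fun q => F q ^ 2) p).comp
        (ContinuousLinearMap.inr ℝ _ _)).toLinearMap).smulRight p.2) with hB
  have hb : ∀ j, jacobiLinear (sprayVec F) p (EuclideanSpace.single j 1) =
      B (EuclideanSpace.single j 1) := by
    intro j
    ext i
    rw [jacobiLinear_apply, ← h.jacobi_eq hp, hΦ p hp]
    have := h.fderiv_sq hp (0, EuclideanSpace.single j 1)
    simp [hB, this, dy, kron]
    ring_nf
    simp
  rw [← jacobiLinear_apply, linear_eq_sum]
  simp_rw [hb]
  rw [← linear_eq_sum]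
  simp [hB]

/-- The identity contributes n F², and Euler's identity for F removes one copy. -/
theorem jacobiTrace_eq (hΦ : HasLocalFlagCurvature F κ V)
    (hp : p ∈ V ×ˢ ({0}ᶜ : Set (Coord n))) :
    jacobiTrace (sprayCoeff F) p = ((n : ℝ) - 1) * (κ p * F p ^ 2) := by
  have h1 : ∑ l, p.2 l * dy l F p = F p := by rw [← fderiv_vertical_eq_sum, h.euler hp]
  have h2 : ∀ l, jacobi (sprayCoeff F) l l p =
      κ p * F p ^ 2 - κ p * F p * (p.2 l * dy l F p) := by
    intro l
    rw [hΦ p hp]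
    simp [kron]
    ring
  unfold jacobiTrace
  simp_rw [h2]
  rw [Finset.sum_sub_distrib, ← Finset.mul_sum (a := κ p * F p), h1]
  simp
  ring

/-- The trace determines κ, as Tr Φ / ((n−1) F²), so its regularity is automatic. -/
theorem smooth_flagCurvature (hn : 3 ≤ n) (hΦ : HasLocalFlagCurvature F κ V)
    (hp : p ∈ V ×ˢ ({0}ᶜ : Set (Coord n))) : ContDiffAt ℝ ∞ κ p := by
  have hn' : (n : ℝ) - 1 ≠ 0 := by
    have : (3 : ℝ) ≤ n := by exact_mod_cast hn
    linarith
  have h1 : ContDiffAt ℝ ∞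
      (fun q => jacobiTrace (sprayCoeff F) q * (((n : ℝ) - 1) * F q ^ 2)⁻¹) p :=
    (h.smooth_jacobiTrace hp).mul ((contDiffAt_const.mul (h.smooth_sq hp)).inv
      (mul_ne_zero hn' (pow_ne_zero 2 (h.pos p hp).ne')))
  refine h1.congr_of_eventuallyEq ?_
  filter_upwards [h.isGeodesicSpray.isOpen.mem_nhds hp] with q hq
  have := (h.pos q hq).ne'
  rw [h.jacobiTrace_eq hΦ hq]
  field_simp

theorem dy_jacobiTrace (hn : 3 ≤ n) (hΦ : HasLocalFlagCurvature F κ V)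
    (hp : p ∈ V ×ˢ ({0}ᶜ : Set (Coord n))) (j : Fin n) :
    dy j (jacobiTrace (sprayCoeff F)) p =
      ((n : ℝ) - 1) * (dy j κ p * F p ^ 2 + 2 * κ p * F p * dy j F p) := by
  have dκ := differentiableAt_of_smooth (h.smooth_flagCurvature hn hΦ hp)
  have dL := differentiableAt_of_smooth (h.smooth_sq hp)
  have e := (dκ.hasFDerivAt.mul dL.hasFDerivAt).const_mul ((n : ℝ) - 1)
  rw [dy, h.isGeodesicSpray.fderiv_congr_on hp fun q hq => h.jacobiTrace_eq hΦ hq]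
  refine (DFunLike.congr_fun e.fderiv _).trans ?_
  simp only [smul_apply, add_apply, h.fderiv_sq hp, smul_eq_mul, dy]
  ring

theorem weylType_eq (hn : 3 ≤ n) (hΦ : HasLocalFlagCurvature F κ V)
    (hp : p ∈ V ×ˢ ({0}ᶜ : Set (Coord n))) (i j : Fin n) :
    weylType (sprayCoeff F) i j p = 1 / 2 * F p ^ 2 * dy j κ p * p.2 i := by
  have hn' : (n : ℝ) - 1 ≠ 0 := by
    have : (3 : ℝ) ≤ n := by exact_mod_cast hn
    linarith
  rw [weylType, hΦ p hp, h.jacobiTrace_eq hΦ hp, h.dy_jacobiTrace hn hΦ hp]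
  field_simp
  ring

/-- Removing the trace part from Φ leaves −κ θ ⊗ C, whose vertical divergence is −((n+1) κ θ + C(κ)
θ); the first summand cancels. Keeping C(κ) avoids having to prove that κ is 0-homogeneous. -/
theorem weyl_eq (hn : 3 ≤ n) (hΦ : HasLocalFlagCurvature F κ V)
    (hp : p ∈ V ×ˢ ({0}ᶜ : Set (Coord n))) (i j : Fin n) :
    weyl (sprayCoeff F) i j p =
      1 / ((n : ℝ) + 1) * fderiv ℝ κ p (0, p.2) * (F p * dy j F p) * p.2 i := by
  have hn3 : (3 : ℝ) ≤ n := by exact_mod_cast hn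
  have hn' : (n : ℝ) - 1 ≠ 0 := by linarith
  have hL := h.smooth_sq hp
  have dκ := differentiableAt_of_smooth (h.smooth_flagCurvature hn hΦ hp)
  set θ : Coord n × Coord n → ℝ :=
    fun q => (1 / 2 : ℝ) * fderiv ℝ (fun q => F q ^ 2) q (0, EuclideanSpace.single j 1) with hθ
  have dθ' : DifferentiableAt ℝ
      (fun q => fderiv ℝ (fun q => F q ^ 2) q (0, EuclideanSpace.single j 1)) p :=
    differentiableAt_of_smooth (contDiffAt_fderiv_apply hL contDiffAt_const)
  have dθ : DifferentiableAt ℝ θ p := dθ'.const_mul _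
  have hθp : ∀ q ∈ V ×ˢ ({0}ᶜ : Set (Coord n)), θ q = F q * dy j F q := by
    intro q hq
    simp only [hθ, h.fderiv_sq hq, dy]
    ring
  -- θ is 1-homogeneous in y: take the vertical derivative of Euler's identity for F².
  have hCθ : fderiv ℝ θ p (0, p.2) = θ p := by
    have h1 := DFunLike.congr_fun (h.isGeodesicSpray.fderiv_congr_on hp
      h.isGeodesicSpray.euler) ((0 : Coord n), EuclideanSpace.single j (1 : ℝ))
    rw [fderiv_fderiv_apply hL (by fun_prop), fderiv_vertical (by fun_prop),
      fderiv_const_mul (differentiableAt_of_smooth hL), fderiv_snd] at h1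
    rw [hθ, fderiv_const_mul dθ', smul_apply, fderiv_fderiv_apply_const hL, snd_fderiv_symm hL]
    simp only [ContinuousLinearMap.coe_snd', smul_apply, smul_eq_mul] at h1 ⊢
    linarith
  have hm : ∀ m, dy m (fun q => jacobi (sprayCoeff F) m j q
      - 1 / ((n : ℝ) - 1) * jacobiTrace (sprayCoeff F) q * kron m j) p =
      -(p.2 m * (κ p * dy m θ p + θ p * dy m κ p) + κ p * θ p) := by
    intro m
    have e0 : HasFDerivAt (fun q : Coord n × Coord n => q.2 m)
        ((EuclideanSpace.proj (𝕜 := ℝ) m).comp (ContinuousLinearMap.snd ℝ _ _)) p :=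
      (EuclideanSpace.proj (𝕜 := ℝ) m).hasFDerivAt.comp p hasFDerivAt_snd
    have e := ((dκ.hasFDerivAt.mul dθ.hasFDerivAt).mul e0).neg
    have e1 : ∀ q ∈ V ×ˢ ({0}ᶜ : Set (Coord n)), jacobi (sprayCoeff F) m j q
        - 1 / ((n : ℝ) - 1) * jacobiTrace (sprayCoeff F) q * kron m j =
        -(κ q * θ q * q.2 m) := by
      intro q hq
      rw [hΦ q hq, h.jacobiTrace_eq hΦ hq, hθp q hq]
      field_simp
      ring
    rw [dy, h.isGeodesicSpray.fderiv_congr_on hp e1]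
    refine (DFunLike.congr_fun e.fderiv _).trans ?_
    simp [dy]
    ring
  have hsum : ∑ m, -(p.2 m * (κ p * dy m θ p + θ p * dy m κ p) + κ p * θ p) =
      -(κ p * fderiv ℝ θ p (0, p.2) + θ p * fderiv ℝ κ p (0, p.2) + n * (κ p * θ p)) := by
    have hc : (n : ℝ) * (κ p * θ p) = ∑ _m : Fin n, κ p * θ p := by simp
    rw [fderiv_vertical_eq_sum θ, fderiv_vertical_eq_sum κ, Finset.mul_sum, Finset.mul_sum, hc,
      ← Finset.sum_add_distrib, ← Finset.sum_add_distrib, ← Finset.sum_neg_distrib]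
    exact Finset.sum_congr rfl fun m _ => by ring
  rw [weyl]
  simp_rw [hm]
  rw [hsum, hCθ, hΦ p hp, h.jacobiTrace_eq hΦ hp, hθp p hp]
  have : (n : ℝ) + 1 ≠ 0 := by linarith
  field_simp
  ring

/-- The flag curvature of a metric with `W₀ = W` does not depend on the direction. -/
theorem vertical_of_weylType_eq_weyl (hn : 3 ≤ n) (hΦ : HasLocalFlagCurvature F κ V)
    (hp : p ∈ V ×ˢ ({0}ᶜ : Set (Coord n)))
    (hW : ∀ i j, weylType (sprayCoeff F) i j p = weyl (sprayCoeff F) i j p) (v : Coord n) :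
    fderiv ℝ κ p (0, v) = 0 := by
  have hn3 : (3 : ℝ) ≤ n := by exact_mod_cast hn
  have hF := h.pos p hp
  obtain ⟨i, hi⟩ : ∃ i, p.2 i ≠ 0 := by
    by_contra! h0
    exact hp.2 (by ext i; simpa using h0 i)
  have h1 : ∀ j, 1 / 2 * F p ^ 2 * dy j κ p =
      1 / ((n : ℝ) + 1) * fderiv ℝ κ p (0, p.2) * (F p * dy j F p) := by
    intro j
    have := hW i j
    rw [h.weylType_eq hn hΦ hp, h.weyl_eq hn hΦ hp] at this
    exact mul_right_cancel₀ hi this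
  have h2 : ∀ v : Coord n, 1 / 2 * F p ^ 2 * fderiv ℝ κ p (0, v) =
      1 / ((n : ℝ) + 1) * fderiv ℝ κ p (0, p.2) * (F p * fderiv ℝ F p (0, v)) := by
    intro v
    rw [fderiv_vertical_eq_sum κ p v, fderiv_vertical_eq_sum F p v, Finset.mul_sum,
      Finset.mul_sum, Finset.mul_sum]
    refine Finset.sum_congr rfl fun k _ => ?_
    linear_combination v k * h1 k
  have h3 := h2 p.2
  rw [h.euler hp] at h3
  have h4 : (1 / 2 - 1 / ((n : ℝ) + 1)) * F p ^ 2 * fderiv ℝ κ p (0, p.2) = 0 := by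
    linear_combination h3
  -- The coefficient vanishes exactly at n = 1.
  have h5 : (0 : ℝ) < 1 / 2 - 1 / ((n : ℝ) + 1) := by
    rw [sub_pos]
    exact one_div_lt_one_div_of_lt (by norm_num) (by linarith)
  have h6 := (mul_eq_zero.1 h4).resolve_left (by positivity)
  have h7 := h2 v
  rw [h6, mul_zero, zero_mul] at h7
  exact (mul_eq_zero.1 h7).resolve_left (by positivity)

theorem flagCurvature_of_weylType_eq_zero (hn : 3 ≤ n)
    (hW : ∀ p ∈ V ×ˢ ({0}ᶜ : Set (Coord n)), ∀ i j, weylType (sprayCoeff F) i j p = 0) :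
    ∃ κ, HasLocalFlagCurvature F κ V ∧
      ∀ p ∈ V ×ˢ ({0}ᶜ : Set (Coord n)), ∀ v, fderiv ℝ κ p (0, v) = 0 := by
  have hn3 : (3 : ℝ) ≤ n := by exact_mod_cast hn
  have hn' : (n : ℝ) - 1 ≠ 0 := by linarith
  set T := jacobiTrace (sprayCoeff F) with hT
  -- Insert the form of Φ given by W₀ = 0 into d_J F² ∘ Φ = 0. This says that T/F² is vertically
  -- constant.
  have hdT : ∀ p ∈ V ×ˢ ({0}ᶜ : Set (Coord n)), ∀ j,
      F p ^ 2 * dy j T p = T p * (2 * F p * dy j F p) := by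
    intro p hp j
    have h1 := h.isGeodesicSpray.fderiv_jacobiMap_eq_zero hp (EuclideanSpace.single j 1)
    have h2 : ∀ i, jacobiMap (sprayVec F) p (EuclideanSpace.single j 1) i =
        1 / ((n : ℝ) - 1) * T p * kron i j - 1 / (2 * ((n : ℝ) - 1)) * dy j T p * p.2 i := by
      intro i
      have := hW p hp i j
      rw [← h.jacobi_eq hp]
      unfold weylType at this
      linear_combination this
    have h3 : jacobiMap (sprayVec F) p (EuclideanSpace.single j 1) =
        (1 / ((n : ℝ) - 1) * T p) • EuclideanSpace.single j (1 : ℝ)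
        - (1 / (2 * ((n : ℝ) - 1)) * dy j T p) • p.2 := by
      ext i
      rw [h2]
      simp [kron]
    have h4 : ((0 : Coord n), jacobiMap (sprayVec F) p (EuclideanSpace.single j 1)) =
        (1 / ((n : ℝ) - 1) * T p) • (0, EuclideanSpace.single j (1 : ℝ))
        - (1 / (2 * ((n : ℝ) - 1)) * dy j T p) • (0, p.2) := by
      rw [h3]; simp
    rw [h4, map_sub, map_smul, map_smul, h.euler_sq hp, h.fderiv_sq hp, smul_eq_mul,
      smul_eq_mul] at h1
    change _ * (2 * F p * dy j F p) - _ = _ at h1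
    field_simp at h1
    linear_combination -h1
  have hΦ : HasLocalFlagCurvature F (fun q => T q * (((n : ℝ) - 1) * F q ^ 2)⁻¹) V := by
    intro p hp i j
    have h1 := hW p hp i j
    have h2 := hdT p hp j
    have hF := (h.pos p hp).ne'
    unfold weylType at h1
    rw [← hT] at h1
    have h3 : dy j T p = T p * (2 * F p * dy j F p) / F p ^ 2 := by
      rw [eq_div_iff (pow_ne_zero 2 hF)]
      linear_combination h2
    rw [h3] at h1
    have h4 : jacobi (sprayCoeff F) i j p = 1 / ((n : ℝ) - 1) * T p * kron i j
        - 1 / (2 * ((n : ℝ) - 1)) * (T p * (2 * F p * dy j F p) / F p ^ 2) * p.2 i := by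
      linear_combination h1
    rw [h4]
    field_simp
  -- From here only isotropy matters: T is recovered from κ by `jacobiTrace_eq`, and `hdT` then
  -- reduces to (n−1) F⁴ ∂κ/∂yʲ = 0.
  generalize (fun q => T q * (((n : ℝ) - 1) * F q ^ 2)⁻¹) = κ at hΦ
  refine ⟨κ, hΦ, fun p hp v => ?_⟩
  have hF := h.pos p hp
  rw [fderiv_vertical_eq_sum]
  refine Finset.sum_eq_zero fun j _ => ?_
  have h1 := hdT p hp j
  rw [h.dy_jacobiTrace hn hΦ hp, hT, h.jacobiTrace_eq hΦ hp] at h1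
  have h2 : ((n : ℝ) - 1) * F p ^ 4 *
      dy j κ p = 0 := by
    linear_combination h1
  rw [(mul_eq_zero.1 h2).resolve_left (mul_ne_zero hn' (by positivity)), mul_zero]

end IsLocalFinsler

end LocalWeyl

/-! ### Tensoriality of the Jacobi endomorphism under induced coordinate changes. -/

section CoordinateChange

variable {E : Type*} [NormedAddCommGroup E] [NormedSpace ℝ E]

/-- The change of induced coordinates `(x, y) ↦ (φ x, Dφ(x) y)`. -/
def inducedChange (φ : E → E) (p : E × E) : E × E := (φ p.1, fderiv ℝ φ p.1 p.2)

theorem hasFDerivAt_comp_fst {W : Type*} [NormedAddCommGroup W] [NormedSpace ℝ W] {f : E → W}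
    {p : E × E} (hf : DifferentiableAt ℝ f p.1) :
    HasFDerivAt (fun q : E × E => f q.1)
      ((fderiv ℝ f p.1).comp (ContinuousLinearMap.fst ℝ E E)) p :=
  hf.hasFDerivAt.comp p hasFDerivAt_fst

theorem hasFDerivAt_base_apply {W : Type*} [NormedAddCommGroup W] [NormedSpace ℝ W]
    {f : E → E →L[ℝ] W} {X : E × E → E} {p : E × E} (hf : DifferentiableAt ℝ f p.1)
    (hX : DifferentiableAt ℝ X p) :
    HasFDerivAt (fun q : E × E => f q.1 (X q))
      ((f p.1).comp (fderiv ℝ X p) +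
        ((fderiv ℝ f p.1).comp (ContinuousLinearMap.fst ℝ E E)).flip (X p)) p :=
  (hasFDerivAt_comp_fst hf).clm_apply hX.hasFDerivAt

theorem hasFDerivAt_inducedChange {φ : E → E} {p : E × E} (hφ : ContDiffAt ℝ ∞ φ p.1) :
    HasFDerivAt (inducedChange φ) (((fderiv ℝ φ p.1).comp (ContinuousLinearMap.fst ℝ E E)).prod
      ((fderiv ℝ φ p.1).comp (ContinuousLinearMap.snd ℝ E E) +
        ((fderiv ℝ (fderiv ℝ φ) p.1).comp (ContinuousLinearMap.fst ℝ E E)).flip p.2)) p := by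
  have h1 := hasFDerivAt_base_apply (X := Prod.snd) (differentiableAt_fderiv hφ)
    (differentiableAt_snd (p := p))
  rw [fderiv_snd] at h1
  exact (hasFDerivAt_comp_fst (differentiableAt_of_smooth hφ)).prodMk h1

theorem fderiv_inducedChange {φ : E → E} {p : E × E} (hφ : ContDiffAt ℝ ∞ φ p.1) (a : E × E) :
    fderiv ℝ (inducedChange φ) p a =
      (fderiv ℝ φ p.1 a.1, fderiv ℝ φ p.1 a.2 + fderiv ℝ (fderiv ℝ φ) p.1 a.1 p.2) := by
  rw [(hasFDerivAt_inducedChange hφ).fderiv]; rfl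

/-- The chain rule for a function of the new coordinates evaluated on a vertical vector. -/
theorem fderiv_vertical_change {W : Type*} [NormedAddCommGroup W] [NormedSpace ℝ W]
    {φ : E → E} {p : E × E} {f : E × E → W} (hφ : ContDiffAt ℝ ∞ φ p.1)
    (hf : ContDiffAt ℝ ∞ f (inducedChange φ p)) (v : E) (a : E × E) :
    fderiv ℝ (fun q => fderiv ℝ f (inducedChange φ q) (0, fderiv ℝ φ q.1 v)) p a =
      fderiv ℝ (fderiv ℝ f) (inducedChange φ p) (fderiv ℝ (inducedChange φ) p a)
        (0, fderiv ℝ φ p.1 v)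
      + fderiv ℝ f (inducedChange φ p) (0, fderiv ℝ (fderiv ℝ φ) p.1 a.1 v) := by
  have h1 : HasFDerivAt (fun q : E × E => fderiv ℝ f (inducedChange φ q))
      ((fderiv ℝ (fderiv ℝ f) (inducedChange φ p)).comp (fderiv ℝ (inducedChange φ) p)) p :=
    (differentiableAt_fderiv hf).hasFDerivAt.comp p
      (hasFDerivAt_inducedChange hφ).differentiableAt.hasFDerivAt
  have h2 := hasFDerivAt_base_apply (X := fun _ => v) (differentiableAt_fderiv hφ)
    (differentiableAt_const (x := p) v)
  have h3 := (hasFDerivAt_const (0 : E) p).prodMk h2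
  refine (DFunLike.congr_fun (h1.clm_apply h3).fderiv a).trans ?_
  simp [add_comm]

/-- Two geodesic sprays related by a change of coordinates that transforms the Lagrangians into
each other. -/
structure IsSprayChange (L : E × E → ℝ) (G : E × E → E) (U : Set (E × E)) (L' : E × E → ℝ)
    (G' : E × E → E) (U' : Set (E × E)) (φ : E → E) (W : Set (E × E)) : Prop where
  left : IsGeodesicSpray L G U
  right : IsGeodesicSpray L' G' U'
  isOpen : IsOpen W
  subset : W ⊆ U
  mapsTo : Set.MapsTo (inducedChange φ) W U'
  smooth : ∀ p ∈ W, ContDiffAt ℝ ∞ φ p.1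
  bijective : ∀ p ∈ W, Function.Bijective (fderiv ℝ φ p.1)
  lagrangian : ∀ p ∈ W, L p = L' (inducedChange φ p)
  nondegenerate : ∀ q ∈ U', ∀ z,
    (∀ v, fderiv ℝ (fderiv ℝ L') q (0, z) (0, v) = 0) → z = 0

namespace IsSprayChange

variable {L L' : E × E → ℝ} {G G' : E × E → E} {U U' W : Set (E × E)} {φ : E → E}
  (h : IsSprayChange L G U L' G' U' φ W) {p : E × E}

include h

theorem fderiv_congr_on {F : Type*} [NormedAddCommGroup F] [NormedSpace ℝ F] {f g : E × E → F}
    (hp : p ∈ W) (hfg : ∀ q ∈ W, f q = g q) : fderiv ℝ f p = fderiv ℝ g p :=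
  Filter.EventuallyEq.fderiv_eq (Filter.eventuallyEq_of_mem (h.isOpen.mem_nhds hp) hfg)

theorem fderiv_lagrangian (hp : p ∈ W) (a : E × E) :
    fderiv ℝ L p a = fderiv ℝ L' (inducedChange φ p) (fderiv ℝ (inducedChange φ) p a) := by
  rw [h.fderiv_congr_on hp h.lagrangian]
  have : HasFDerivAt (fun q => L' (inducedChange φ q))
      ((fderiv ℝ L' (inducedChange φ p)).comp (fderiv ℝ (inducedChange φ) p)) p :=
    (differentiableAt_of_smooth (h.right.smoothL _ (h.mapsTo hp))).hasFDerivAt.comp p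
      (hasFDerivAt_inducedChange (h.smooth p hp)).differentiableAt.hasFDerivAt
  rw [this.fderiv]; rfl

theorem fderiv_lagrangian_vertical (hp : p ∈ W) (v : E) :
    fderiv ℝ L p (0, v) = fderiv ℝ L' (inducedChange φ p) (0, fderiv ℝ φ p.1 v) := by
  rw [h.fderiv_lagrangian hp, fderiv_inducedChange (h.smooth p hp)]
  simp

/-- The geodesic sprays are related by the change of coordinates. -/
theorem fderiv_sprayField (hp : p ∈ W) :
    fderiv ℝ (inducedChange φ) p (sprayField G p) = sprayField G' (inducedChange φ p) := by
  have hφ := h.smooth p hp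
  have hq := h.mapsTo hp
  -- The transported spray satisfies the Euler–Lagrange equation of L' as well; the second
  -- derivatives of φ cancel by symmetry. The difference of the two sprays is vertical, so
  -- nondegeneracy of the fibre Hessian kills it.
  have key : ∀ v, fderiv ℝ (fderiv ℝ L') (inducedChange φ p)
      (fderiv ℝ (inducedChange φ) p (sprayField G p)) (0, fderiv ℝ φ p.1 v) =
      fderiv ℝ (fderiv ℝ L') (inducedChange φ p)
        (sprayField G' (inducedChange φ p)) (0, fderiv ℝ φ p.1 v) := by
    intro v
    have h1 := DFunLike.congr_fun (h.fderiv_congr_on hp fun q hq =>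
      h.fderiv_lagrangian_vertical hq v) (sprayField G p)
    rw [fderiv_fderiv_apply_const (h.left.smoothL p (h.subset hp)),
      h.left.eulerLagrange p (h.subset hp), h.fderiv_lagrangian hp,
      fderiv_vertical_change hφ (h.right.smoothL _ hq), fderiv_inducedChange hφ (v, 0)] at h1
    rw [h.right.eulerLagrange _ hq]
    simp only [map_zero, zero_add] at h1
    rw [pair_split, snd_fderiv_symm hφ v p.2] at h1
    exact (add_right_cancel h1).symm
  set z := fderiv ℝ (inducedChange φ) p (sprayField G p) - sprayField G' (inducedChange φ p)
    with hz
  have hz1 : z = (0, z.2) := by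
    refine Prod.ext ?_ rfl
    rw [hz, fderiv_inducedChange hφ]
    simp [sprayField, inducedChange]
  have hz2 : z.2 = 0 := by
    refine h.nondegenerate _ hq z.2 fun w => ?_
    obtain ⟨v, rfl⟩ := (h.bijective p hp).2 w
    rw [← hz1, hz, map_sub, sub_apply, key, sub_self]
  rw [hz2] at hz1
  exact sub_eq_zero.1 hz1

theorem sprayCoeff_change (hp : p ∈ W) :
    G' (inducedChange φ p) = fderiv ℝ φ p.1 (G p)
      - (1 / 2 : ℝ) • fderiv ℝ (fderiv ℝ φ) p.1 p.2 p.2 := by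
  have h1 := congrArg Prod.snd (h.fderiv_sprayField hp)
  rw [fderiv_inducedChange (h.smooth p hp)] at h1
  simp only [sprayField, map_smul] at h1
  have h2 : G' (inducedChange φ p) = (-(1 / 2) : ℝ) • (-(2 : ℝ) • G' (inducedChange φ p)) := by
    module
  rw [h2, ← h1]
  module

theorem fderiv_sprayCoeff_change (hp : p ∈ W) (a : E × E) :
    fderiv ℝ G' (inducedChange φ p) (fderiv ℝ (inducedChange φ) p a) =
      fderiv ℝ (fderiv ℝ φ) p.1 a.1 (G p) + fderiv ℝ φ p.1 (fderiv ℝ G p a)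
      - (1 / 2 : ℝ) • (fderiv ℝ (fderiv ℝ (fderiv ℝ φ)) p.1 a.1 p.2 p.2
        + (2 : ℝ) • fderiv ℝ (fderiv ℝ φ) p.1 p.2 a.2) := by
  have hφ := h.smooth p hp
  have dG := differentiableAt_of_smooth (h.left.smoothG p (h.subset hp))
  have h0 : HasFDerivAt (fun q => G' (inducedChange φ q))
      ((fderiv ℝ G' (inducedChange φ p)).comp (fderiv ℝ (inducedChange φ) p)) p :=
    (differentiableAt_of_smooth (h.right.smoothG _ (h.mapsTo hp))).hasFDerivAt.comp p
      (hasFDerivAt_inducedChange hφ).differentiableAt.hasFDerivAt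
  have h1 := hasFDerivAt_base_apply (X := G) (differentiableAt_fderiv hφ) dG
  have h2 := hasFDerivAt_base_apply (X := Prod.snd)
    (differentiableAt_fderiv (contDiffAt_fderiv hφ)) (differentiableAt_snd (p := p))
  have h3 := h2.clm_apply (hasFDerivAt_snd (𝕜 := ℝ) (p := p))
  have h4 := h1.sub (h3.const_smul (1 / 2 : ℝ))
  have h5 := h.fderiv_congr_on hp fun q hq => h.sprayCoeff_change hq
  rw [h0.fderiv] at h5
  refine (DFunLike.congr_fun h5 a).trans ((DFunLike.congr_fun h4.fderiv a).trans ?_)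
  simp only [fderiv_snd, sub_apply, add_apply, smul_apply, ContinuousLinearMap.comp_apply,
    ContinuousLinearMap.flip_apply, ContinuousLinearMap.coe_fst', ContinuousLinearMap.coe_snd',
    snd_fderiv_symm hφ a.2 p.2]
  module

theorem fderiv_sprayCoeff_vertical (hp : p ∈ W) (v : E) :
    fderiv ℝ G' (inducedChange φ p) (0, fderiv ℝ φ p.1 v) =
      fderiv ℝ φ p.1 (fderiv ℝ G p (0, v)) - fderiv ℝ (fderiv ℝ φ) p.1 p.2 v := by
  have h1 := h.fderiv_sprayCoeff_change hp (0, v)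
  rw [fderiv_inducedChange (h.smooth p hp)] at h1
  simp only [map_zero, zero_apply, add_zero, zero_add] at h1
  rw [h1]
  module

/-- The Jacobi endomorphism is a tensor. -/
theorem jacobiMap_change (hp : p ∈ W) (v : E) :
    jacobiMap G' (inducedChange φ p) (fderiv ℝ φ p.1 v) = fderiv ℝ φ p.1 (jacobiMap G p v) := by
  have hφ := h.smooth p hp
  have hG := h.left.smoothG p (h.subset hp)
  have hq := h.mapsTo hp
  have hN : DifferentiableAt ℝ (fun q => fderiv ℝ G q (0, v)) p :=
    differentiableAt_of_smooth (contDiffAt_fderiv_apply hG contDiffAt_const)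
  -- `e1` transforms the ∂G/∂x term of Φ and `e2` the S(∂G/∂y) term. Their inhomogeneous parts in
  -- D²φ and D³φ cancel when Φ is assembled.
  have e1 := h.fderiv_sprayCoeff_change hp (v, 0)
  rw [fderiv_inducedChange hφ] at e1
  simp only [map_zero, smul_zero, add_zero, zero_add] at e1
  rw [pair_split, snd_fderiv_symm hφ v p.2] at e1
  have e2 := DFunLike.congr_fun (h.fderiv_congr_on hp fun q hq =>
    h.fderiv_sprayCoeff_vertical hq v) (sprayField G p)
  rw [fderiv_vertical_change hφ (h.right.smoothG _ hq), h.fderiv_sprayField hp] at e2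
  have h1 := hasFDerivAt_base_apply (differentiableAt_fderiv hφ) hN
  have h2 := hasFDerivAt_base_apply (X := Prod.snd)
    (differentiableAt_fderiv (contDiffAt_fderiv hφ)) (differentiableAt_snd (p := p))
  have h3 := h2.clm_apply (hasFDerivAt_const v p)
  have e3 := DFunLike.congr_fun (h1.sub h3).fderiv (sprayField G p)
  have e4 := e2.trans e3
  simp only [sprayField, fderiv_snd, sub_apply, add_apply, ContinuousLinearMap.comp_apply,
    ContinuousLinearMap.flip_apply, ContinuousLinearMap.coe_fst', ContinuousLinearMap.coe_snd',
    zero_apply, map_zero, zero_add, map_smul, smul_apply,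
    fderiv_fderiv_apply_const hG] at e4
  have t1 : fderiv ℝ (fderiv ℝ (fderiv ℝ φ)) p.1 v p.2 p.2 =
      fderiv ℝ (fderiv ℝ (fderiv ℝ φ)) p.1 p.2 p.2 v := by
    rw [snd_fderiv_symm (contDiffAt_fderiv hφ), trd_fderiv_symm hφ]
  have t2 := h.fderiv_sprayCoeff_vertical hp (fderiv ℝ G p (0, v))
  have e5 : ((0 : E), fderiv ℝ G' (inducedChange φ p) (0, fderiv ℝ φ p.1 v)) =
      (0, fderiv ℝ φ p.1 (fderiv ℝ G p (0, v))) - (0, fderiv ℝ (fderiv ℝ φ) p.1 p.2 v) := by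
    rw [h.fderiv_sprayCoeff_vertical hp]; simp
  rw [t1, snd_fderiv_symm hφ v (G p)] at e1
  rw [jacobiMap, e5, map_sub, t2, jacobiMap, map_sub, map_sub, map_smul,
    eq_sub_of_add_eq e1]
  simp only [sprayField]
  rw [eq_sub_of_add_eq e4]
  module

/-- A scalar flag curvature is a function on the tangent bundle. -/
theorem isotropic_unique [FiniteDimensional ℝ E] (hdim : 2 ≤ Module.finrank ℝ E)
    {κ κ' : E × E → ℝ} (hΦ : IsIsotropicOn L G κ U) (hΦ' : IsIsotropicOn L' G' κ' U')
    (hp : p ∈ W) (hL : L p ≠ 0) : κ' (inducedChange φ p) = κ p := by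
  -- For v off the line of y, the vector L v − θ(v) y is nonzero, so Φ v determines κ.
  obtain ⟨v, -, hv⟩ := exists_mem_not_mem_span (K := (⊤ : Submodule ℝ E)) (by simpa using hdim) p.2
  have h1 := h.jacobiMap_change hp v
  rw [hΦ p (h.subset hp), hΦ' _ (h.mapsTo hp), ← h.lagrangian p hp,
    ← h.fderiv_lagrangian_vertical hp] at h1
  set w := L p • v - ((1 / 2 : ℝ) * fderiv ℝ L p (0, v)) • p.2 with hw
  have hDw : fderiv ℝ φ p.1 w = L p • fderiv ℝ φ p.1 v
      - ((1 / 2 : ℝ) * fderiv ℝ L p (0, v)) • (inducedChange φ p).2 := by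
    rw [hw, map_sub, map_smul, map_smul]; rfl
  have h2 : fderiv ℝ φ p.1 ((κ' (inducedChange φ p) - κ p) • w) = fderiv ℝ φ p.1 0 := by
    rw [map_zero, sub_smul, map_sub, map_smul, hDw, h1, sub_self]
  have h3 := (h.bijective p hp).1 h2
  rcases smul_eq_zero.1 h3 with h4 | h4
  · exact sub_eq_zero.1 h4
  · exact absurd (mem_span_of_smul_eq hL (sub_eq_zero.1 h4)) hv

end IsSprayChange

end CoordinateChange

/-! ### Passage from charts to the manifold. -/

section Manifold

open Set Filter Topology

variable {n : ℕ}

/-- The Legendre form of a Finsler metric is nondegenerate. -/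
theorem IsLocalFinsler.nondegenerate {F : Coord n × Coord n → ℝ} {V : Set (Coord n)}
    (h : IsLocalFinsler F V) {p : Coord n × Coord n} (hp : p ∈ V ×ˢ ({0}ᶜ : Set (Coord n)))
    (z : Coord n)
    (hz : ∀ v, fderiv ℝ (fderiv ℝ fun q => F q ^ 2) p (0, z) (0, v) = 0) : z = 0 := by
  have hL := h.smooth_sq hp
  have h1 : (metricTensor F p).mulVec z = 0 := by
    ext i
    have h2 := linear_eq_sum ((fderiv ℝ (fderiv ℝ fun q => F q ^ 2) p
      (0, EuclideanSpace.single i 1)).comp (ContinuousLinearMap.inr ℝ _ _)).toLinearMap z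
    have h3 : fderiv ℝ (fderiv ℝ fun q => F q ^ 2) p (0, EuclideanSpace.single i 1) (0, z) = 0 := by
      rw [snd_fderiv_symm hL, hz]
    have h4 := h2.symm.trans h3
    simp only [Matrix.mulVec, dotProduct, Pi.zero_apply]
    have h5 : ∀ j, metricTensor F p i j * z j = (1 / 2 : ℝ) * (z j *
        fderiv ℝ (fderiv ℝ fun q => F q ^ 2) p (0, EuclideanSpace.single i 1)
          (0, EuclideanSpace.single j 1)) := by
      intro j
      have h6 : metricTensor F p i j = (1 / 2 : ℝ) *
          fderiv ℝ (fun q => fderiv ℝ (fun q => F q ^ 2) q (0, EuclideanSpace.single j 1)) p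
            (0, EuclideanSpace.single i 1) := rfl
      rw [h6, fderiv_fderiv_apply_const hL]
      ring
    simp_rw [h5]
    rw [← Finset.mul_sum]
    exact (congrArg ((1 / 2 : ℝ) * ·) h4).trans (mul_zero _)
  have h2 : (z : Fin n → ℝ) = 0 :=
    Matrix.eq_zero_of_mulVec_eq_zero (h.posDef p hp).det_pos.ne' h1
  ext i
  exact congrFun h2 i

variable {M : Type*} [TopologicalSpace M] [ChartedSpace (Coord n) M]

theorem tangentBundle_mk_eq {x x' : M} (hx : x = x') {v v' : Coord n} (hv : v = v') :
    (⟨x, v⟩ : TangentBundle (𝓡 n) M) = ⟨x', v'⟩ := by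
  subst hx hv; rfl

theorem contMDiff_tangentBundle_mk :
    ContMDiff 𝓘(ℝ, Coord n × Coord n) (𝓡 n).tangent ∞
      (fun p : Coord n × Coord n => (⟨p.1, p.2⟩ : TangentBundle (𝓡 n) (Coord n))) := by
  intro p
  rw [Bundle.contMDiffAt_totalSpace]
  refine ⟨contDiff_fst.contMDiff.contMDiffAt, ?_⟩
  simp only [trivializationAt_model_space_apply]
  exact contDiff_snd.contMDiff.contMDiffAt

variable {e e' : OpenPartialHomeomorph M (Coord n)}

theorem mdifferentiable_of_mem_maximalAtlas (he : e ∈ IsManifold.maximalAtlas (𝓡 n) ∞ M) :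
    e.MDifferentiable (𝓡 n) (𝓡 n) :=
  ⟨(contMDiffOn_of_mem_maximalAtlas he).mdifferentiableOn (by simp),
    (contMDiffOn_symm_of_mem_maximalAtlas he).mdifferentiableOn (by simp)⟩

theorem vectorOfCoord_mem_slit (he : e ∈ IsManifold.maximalAtlas (𝓡 n) ∞ M)
    {p : Coord n × Coord n} (hp : p ∈ e.target ×ˢ ({0}ᶜ : Set (Coord n))) :
    vectorOfCoord e p ∈ slit n M := by
  intro h0
  refine hp.2 ((mdifferentiable_of_mem_maximalAtlas he).symm.mfderiv_injective hp.1 ?_)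
  exact Eq.trans h0 (map_zero _).symm

theorem vectorOfCoord_inducedChange (he : e ∈ IsManifold.maximalAtlas (𝓡 n) ∞ M)
    (he' : e' ∈ IsManifold.maximalAtlas (𝓡 n) ∞ M) {p : Coord n × Coord n}
    (hp : p.1 ∈ (e.symm.trans e').source) :
    vectorOfCoord e p = vectorOfCoord e' (inducedChange (e.symm.trans e') p) := by
  have hd := (mdifferentiable_of_mem_maximalAtlas he).symm.trans
    (mdifferentiable_of_mem_maximalAtlas he')
  have hp' : e.symm p.1 ∈ e'.source := by simpa using hp.2
  have ht : (e.symm.trans e') p.1 ∈ e'.target := by simpa using e'.map_source hp'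
  have hd' := (mdifferentiable_of_mem_maximalAtlas he').mdifferentiableAt_symm ht
  refine tangentBundle_mk_eq ?_ ?_
  · exact (e'.left_inv hp').symm
  · have h1 : e'.symm ∘ (e.symm.trans e') =ᶠ[𝓝 p.1] e.symm := by
      filter_upwards [(e.symm.trans e').open_source.mem_nhds hp] with x hx
      exact e'.left_inv (by simpa using hx.2)
    have h2 := mfderiv_comp p.1 hd' (hd.mdifferentiableAt hp)
    rw [mfderiv_eq_fderiv] at h2
    have h3 := h1.mfderiv_eq (I := 𝓡 n) (I' := 𝓡 n)
    exact DFunLike.congr_fun (h3.symm.trans h2) p.2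

variable [IsManifold (𝓡 n) ∞ M]

/-- This is the tangent map of `e.symm` on Tℝⁿ ≅ ℝⁿ × ℝⁿ; on the open set `e.target` it agrees with
the tangent map within that set. -/
theorem contMDiffOn_vectorOfCoord (he : e ∈ IsManifold.maximalAtlas (𝓡 n) ∞ M) :
    ContMDiffOn 𝓘(ℝ, Coord n × Coord n) (𝓡 n).tangent ∞ (vectorOfCoord e)
      (e.target ×ˢ (univ : Set (Coord n))) := by
  have : IsManifold (𝓡 n) 1 M := IsManifold.of_le (n := ∞) (by norm_cast)
  have h1 := (contMDiffOn_symm_of_mem_maximalAtlas he).contMDiffOn_tangentMapWithin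
    (m := ∞) (by norm_cast) e.open_target.uniqueMDiffOn
  have h2 := h1.comp contMDiff_tangentBundle_mk.contMDiffOn (s := e.target ×ˢ univ)
    (fun p hp => hp.1)
  refine h2.congr fun p hp => ?_
  exact (tangentMapWithin_eq_tangentMap (p := ⟨p.1, p.2⟩) (e.open_target.uniqueMDiffOn _ hp.1)
    ((mdifferentiable_of_mem_maximalAtlas he).mdifferentiableAt_symm hp.1)).symm

variable {F : TangentBundle (𝓡 n) M → ℝ}

theorem IsFinslerMetric.isLocalFinsler (hF : IsFinslerMetric F)
    (he : e ∈ IsManifold.maximalAtlas (𝓡 n) ∞ M) : IsLocalFinsler (inChart F e) e.target where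
  isOpen := e.open_target
  smooth p hp := by
    have hopen : IsOpen (e.target ×ˢ ({0}ᶜ : Set (Coord n))) :=
      e.open_target.prod isOpen_compl_singleton
    have h1 : ContMDiffOn 𝓘(ℝ, Coord n × Coord n) 𝓘(ℝ, ℝ) ∞ (inChart F e)
        (e.target ×ˢ ({0}ᶜ : Set (Coord n))) :=
      hF.smooth.comp ((contMDiffOn_vectorOfCoord he).mono (prod_mono_right (subset_univ _)))
        fun p hp => vectorOfCoord_mem_slit he hp
    exact (contMDiffOn_iff_contDiffOn.1 h1).contDiffAt (hopen.mem_nhds hp)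
  pos p hp := hF.pos _ (vectorOfCoord_mem_slit he hp)
  homogeneous p _ c hc := by
    have h1 := hF.homogeneous (e.symm p.1) (mfderiv (𝓡 n) (𝓡 n) e.symm p.1 p.2) c hc
    exact (congrArg (fun w => F ⟨e.symm p.1, w⟩)
      ((mfderiv (𝓡 n) (𝓡 n) e.symm p.1).map_smul c p.2)).trans h1
  posDef p hp := hF.posDef e p ⟨he, hp.1, hp.2⟩

theorem IsFinslerMetric.isSprayChange (hF : IsFinslerMetric F)
    (he : e ∈ IsManifold.maximalAtlas (𝓡 n) ∞ M) (he' : e' ∈ IsManifold.maximalAtlas (𝓡 n) ∞ M) :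
    IsSprayChange (fun q => inChart F e q ^ 2) (sprayVec (inChart F e)) (e.target ×ˢ {0}ᶜ)
      (fun q => inChart F e' q ^ 2) (sprayVec (inChart F e')) (e'.target ×ˢ {0}ᶜ)
      (e.symm.trans e') ((e.symm.trans e').source ×ˢ {0}ᶜ) := by
  have hd := (mdifferentiable_of_mem_maximalAtlas he).symm.trans
    (mdifferentiable_of_mem_maximalAtlas he')
  have hbij : ∀ p ∈ (e.symm.trans e').source ×ˢ ({0}ᶜ : Set (Coord n)),
      Function.Bijective (fderiv ℝ (e.symm.trans e') p.1) := by
    intro p hp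
    rw [← mfderiv_eq_fderiv]
    exact hd.mfderiv_bijective hp.1
  refine ⟨(hF.isLocalFinsler he).isGeodesicSpray, (hF.isLocalFinsler he').isGeodesicSpray,
    (e.symm.trans e').open_source.prod isOpen_compl_singleton,
    prod_mono_left fun x hx => hx.1, ?_, ?_, hbij, ?_, ?_⟩
  · intro p hp
    refine ⟨((e.symm.trans e').map_source hp.1).1, fun h0 => hp.2 ?_⟩
    exact (hbij p hp).1 (Eq.trans h0 (map_zero _).symm)
  · intro p hp
    have hp' : e.symm p.1 ∈ e'.source := by simpa using hp.1.2
    have h1 : ContMDiffAt (𝓡 n) (𝓡 n) ∞ (e' ∘ e.symm) p.1 :=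
      (contMDiffAt_of_mem_maximalAtlas he' hp').comp p.1
        (contMDiffAt_symm_of_mem_maximalAtlas he hp.1.1)
    exact h1.contDiffAt
  · intro p hp
    simp only [inChart]
    rw [vectorOfCoord_inducedChange he he' hp.1]
  · intro q hq z hz
    exact (hF.isLocalFinsler he').nondegenerate hq z hz

/-- If the flag curvature is, in each chart, a function that does not depend on the direction, then
it is constant. -/
theorem IsFinslerMetric.hasConstantFlagCurvature [PreconnectedSpace M] (hF : IsFinslerMetric F)
    (hn : 3 ≤ n)
    (hloc : ∀ e ∈ IsManifold.maximalAtlas (𝓡 n) ∞ M,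
      ∃ κ, HasLocalFlagCurvature (inChart F e) κ e.target ∧
        ∀ p ∈ e.target ×ˢ ({0}ᶜ : Set (Coord n)), ∀ v, fderiv ℝ κ p (0, v) = 0) :
    HasConstantFlagCurvature F := by
  rcases isEmpty_or_nonempty M with hM | hM
  · exact ⟨0, fun e p _ => (hM.false (e.symm p.1)).elim⟩
  -- The functions are chosen chart by chart with no compatibility between them; `hκc` establishes
  -- it.
  choose! κ hκ hvert using hloc
  have hfin : Module.finrank ℝ (Coord n) = n := by simp
  have hrank : 1 < Module.rank ℝ (Coord n) := by
    rw [← Module.finrank_eq_rank, hfin]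
    exact_mod_cast (by omega : 1 < n)
  have hiso := fun e he => (hF.isLocalFinsler (e := e) he).isIsotropicOn (hκ e he)
  have hdiff : ∀ e ∈ IsManifold.maximalAtlas (𝓡 n) ∞ M,
      ∀ p ∈ e.target ×ˢ ({0}ᶜ : Set (Coord n)), DifferentiableAt ℝ (κ e) p := fun e he p hp =>
    differentiableAt_of_smooth ((hF.isLocalFinsler he).smooth_flagCurvature hn (hκ e he) hp)
  have hschur : ∀ e ∈ IsManifold.maximalAtlas (𝓡 n) ∞ M,
      ∀ p ∈ e.target ×ˢ ({0}ᶜ : Set (Coord n)), fderiv ℝ (κ e) p = 0 := fun e he p hp =>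
    (hF.isLocalFinsler he).isGeodesicSpray.schur (by rw [hfin]; exact hn) rfl
      (fun q hq => pow_pos ((hF.isLocalFinsler he).pos q hq) 2) (hdiff e he) (hiso e he)
      (hvert e he) hp
  set y₀ : Coord n := EuclideanSpace.single ⟨0, by omega⟩ 1 with hy₀
  have hy₀' : y₀ ≠ 0 := by simp [hy₀]
  -- The candidate function on M samples the preferred chart in a fixed direction; by vertical
  -- constancy the direction does not matter.
  set c : M → ℝ := fun x => κ (chartAt (Coord n) x) (chartAt (Coord n) x x, y₀) with hc
  have hκc : ∀ e ∈ IsManifold.maximalAtlas (𝓡 n) ∞ M,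
      ∀ p ∈ e.target ×ˢ ({0}ᶜ : Set (Coord n)), κ e p = c (e.symm p.1) := by
    intro e he p hp
    set e' := chartAt (Coord n) (e.symm p.1) with he'_def
    have he' : e' ∈ IsManifold.maximalAtlas (𝓡 n) ∞ M := IsManifold.chart_mem_maximalAtlas _
    have hch := hF.isSprayChange he he'
    have hp' : p ∈ (e.symm.trans e').source ×ˢ ({0}ᶜ : Set (Coord n)) := by
      refine ⟨?_, hp.2⟩
      simpa using ⟨hp.1, mem_chart_source (Coord n) (e.symm p.1)⟩
    rw [← hch.isotropic_unique (by rw [hfin]; omega) (hiso e he) (hiso e' he') hp'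
      (pow_ne_zero 2 ((hF.isLocalFinsler he).pos p hp).ne')]
    have hq := hch.mapsTo hp'
    exact eq_of_vertical_fderiv_eq_zero hrank (hdiff e' he') (hvert e' he') hq.1 hq.2 hy₀'
  have hlc : IsLocallyConstant c := by
    rw [IsLocallyConstant.iff_eventually_eq]
    intro x
    set e := chartAt (Coord n) x with he_def
    have he : e ∈ IsManifold.maximalAtlas (𝓡 n) ∞ M := IsManifold.chart_mem_maximalAtlas _
    have hx : x ∈ e.source := mem_chart_source _ x
    obtain ⟨r, hr, hball⟩ := Metric.isOpen_iff.1 e.open_target (e x) (e.map_source hx)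
    have hd : ∀ a ∈ Metric.ball (e x) r, HasFDerivAt (fun a => κ e (a, y₀))
        (0 : Coord n →L[ℝ] ℝ) a := by
      intro a ha
      have hmem : (a, y₀) ∈ e.target ×ˢ ({0}ᶜ : Set (Coord n)) := ⟨hball ha, hy₀'⟩
      have h1 : HasFDerivAt (fun a => κ e (a, y₀))
          ((fderiv ℝ (κ e) (a, y₀)).comp (ContinuousLinearMap.inl ℝ _ _)) a :=
        (hdiff e he _ hmem).hasFDerivAt.comp a (hasFDerivAt_prodMk_left a y₀)
      rw [hschur e he _ hmem] at h1
      simpa using h1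
    have hconst : ∀ a ∈ Metric.ball (e x) r, κ e (a, y₀) = κ e (e x, y₀) := fun a ha =>
      Metric.isOpen_ball.is_const_of_fderiv_eq_zero (𝕜 := ℝ) (f := fun a => κ e (a, y₀))
        (convex_ball _ _).isPreconnected
        (fun b hb => (hd b hb).differentiableAt.differentiableWithinAt)
        (fun b hb => (hd b hb).fderiv) ha (Metric.mem_ball_self hr)
    have hcont : e ⁻¹' Metric.ball (e x) r ∈ 𝓝 x :=
      (e.continuousAt hx).preimage_mem_nhds (Metric.ball_mem_nhds _ hr)
    filter_upwards [hcont, e.open_source.mem_nhds hx] with z hz hz'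
    have h1 := hκc e he (e z, y₀) ⟨e.map_source hz', hy₀'⟩
    have h2 := hκc e he (e x, y₀) ⟨e.map_source hx, hy₀'⟩
    simp only [e.left_inv hz', e.left_inv hx] at h1 h2
    rw [← h1, ← h2, hconst _ hz]
  obtain ⟨c₀, hc₀⟩ := hlc.exists_eq_const
  refine ⟨c₀, fun e p hp i j => ?_⟩
  have hp' : p ∈ e.target ×ˢ ({0}ᶜ : Set (Coord n)) := ⟨hp.2.1, hp.2.2⟩
  have h1 := hκ e hp.1 p hp' i j
  rw [hκc e hp.1 p hp', hc₀] at h1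
  exact h1

end Manifold

end FinslerGeom

end

/-! ### The equivalence. -/

theorem theorem4p1 (n : ℕ) (hn : 3 ≤ n) (M : Type*) [TopologicalSpace M]
    [ChartedSpace (FinslerGeom.Coord n) M] [IsManifold (𝓡 n) ∞ M] [PreconnectedSpace M]
    (F : TangentBundle (𝓡 n) M → ℝ) (hF : FinslerGeom.IsFinslerMetric F) :
    List.TFAE [
      FinslerGeom.HasConstantFlagCurvature F,
      FinslerGeom.WeylTypeVanishes F,
      FinslerGeom.HasScalarFlagCurvature F ∧ FinslerGeom.WeylTypeEqWeyl F] := by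
  have hlocal : ∀ {κ : TangentBundle (𝓡 n) M → ℝ}, FinslerGeom.HasFlagCurvature F κ →
      ∀ e ∈ IsManifold.maximalAtlas (𝓡 n) ∞ M, FinslerGeom.HasLocalFlagCurvature
        (FinslerGeom.inChart F e) (FinslerGeom.inChart κ e) e.target :=
    fun hκ e he p hp i j => hκ e p ⟨he, hp.1, hp.2⟩ i j
  tfae_have 1 → 2 := by
    rintro ⟨c, hc⟩ e p ⟨he, hp⟩ i j
    rw [FinslerGeom.sprayInChart, (hF.isLocalFinsler he).weylType_eq hn (hlocal hc e he) hp]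
    have h0 : fderiv ℝ (FinslerGeom.inChart (fun _ : TangentBundle (𝓡 n) M => c) e) p = 0 :=
      fderiv_const_apply c
    simp [FinslerGeom.dy, h0]
  tfae_have 2 → 1 := fun hW => hF.hasConstantFlagCurvature hn fun e he =>
    (hF.isLocalFinsler he).flagCurvature_of_weylType_eq_zero hn
      fun p hp i j => hW e p ⟨he, hp.1, hp.2⟩ i j
  tfae_have 3 → 1 := by
    rintro ⟨⟨κ, -, hκ⟩, hW⟩
    exact hF.hasConstantFlagCurvature hn fun e he => ⟨_, hlocal hκ e he, fun p hp v =>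
      (hF.isLocalFinsler he).vertical_of_weylType_eq_weyl hn (hlocal hκ e he) hp
        (fun i j => hW e p ⟨he, hp.1, hp.2⟩ i j) v⟩
  tfae_have 1 → 3 := by
    rintro ⟨c, hc⟩
    refine ⟨⟨fun _ => c, contMDiffOn_const, hc⟩, ?_⟩
    rintro e p ⟨he, hp⟩ i j
    rw [FinslerGeom.sprayInChart, (hF.isLocalFinsler he).weylType_eq hn (hlocal hc e he) hp,
      (hF.isLocalFinsler he).weyl_eq hn (hlocal hc e he) hp]
    have h0 : fderiv ℝ (FinslerGeom.inChart (fun _ : TangentBundle (𝓡 n) M => c) e) p = 0 :=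
      fderiv_const_apply c
    simp [FinslerGeom.dy, h0]
  tfae_finish
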